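/- **Setting.** Let $n,r,q$ be nonnegative integers, $\lambda\ge 0$, $b\in\mathbb R^q$, let $\mathcal A:\mathbb R^{n\times n}\to\mathbb R^q$ be linear with adjoint $\mathcal A^*$ (Frobenius and Euclidean inner products), and let $\Psi,\Phi:\mathbb R^{n\times r}\to\mathbb R\cup\{+\infty\}$. Put $$\mathcal F_\lambda(X,Y)=\Psi(X)+\Phi(Y)+\tfrac12\|\mathcal A(XY^\top)-b\|^2+\tfrac\lambda2\|X-Y\|_F^2 .$$ $\|\cdot\|$ on matrices is the spectral norm, $\|\cdot\|_F$ the Frobenius norm. For $h$ with values in $\mathbb R\cup\{+\infty\}$, $\widehat\partial h(x)$ ($x\in\mathrm{dom}\,h$) is the set of $D$ with $h(y)\ge h(x)+\langle D,y-x\rangle+o(\|y-x\|)$ as $y\to x$; $\partial h(x)$ ($x\in\mathrm{dom}\,h$) is the set of limits of $D^k\in\widehat\partial h(x^k)$ with $x^k\to x$, $h(x^k)\to h(x)$; $\partial h(x)=\emptyset$ off $\mathrm{dom}\,h$; $x$ is stationary if $0\in\partial h(x)$. $h$ is a KL function if for every $\tilde x$ with $\partial h(\tilde x)\ne\emptyset$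 there are $\nu\in(0,\infty]$, a neighbourhood $\mathcal V$ of $\tilde x$ and a concave $\varphi:[0,\nu)\to\mathbb R_+$ with $\varphi(0)=0$, $\varphi$ continuous at $0$ and $C^1$ with $\varphi'>0$ on $(0,\nu)$, such that $\varphi'(h(x)-h(\tilde x))\,\mathrm{dist}(0,\partial h(x))\ge1$ whenever $x\in\mathcal V$ and $h(\tilde x)<h(x)<h(\tilde x)+\nu$ (with $\mathrm{dist}(0,\emptyset)=+\infty$). **Assumption A.** (i) $\Psi,\Phi$ are proper, lower semicontinuous and bounded from below; (ii) $\mathcal A\mathcal A^*=\mathcal I_q$; (iii) $\alpha,\beta\in\mathbb R\setminus\{0\}$ and $\frac1\alpha+\frac1\beta=1$; (iv) if $\lambda=0$, or if $\mathcal A(XX^\top)=0$ for some nonzero $X\in\mathbb R^{n\times r}$, then $\mathcal F_\lambda$ is level-bounded, i.e. $\{\mathcal F_\lambda\le t\}$ is bounded for every $t\in\mathbb R$. (If $\lambda>0$ and no such $X$ exists, e.g. if $\mathcal A$ is injective, nothing is assumed in (iv).) **A-NAUM.** Parameters: $\alpha,\beta$ as in (iii), $\mu^{\min}>0$, $0<\sigma^{\min}<\sigma^{\max}$,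 $\tau>1$, $c>0$, $0<p_{\min}<1$, $\rho=\|\mathcal I-\frac{\beta}{\alpha+\beta}\mathcal A^*\mathcal A\|^2$, and $\gamma\ge0$ with $(\alpha+\gamma)\mathcal I+\beta\mathcal A^*\mathcal A\succeq0$. Start at $(X^0,Y^0)\in\mathrm{dom}\,\mathcal F_\lambda$ with $\mathcal R_0=\mathcal F_\lambda(X^0,Y^0)$. Let $\mathcal H(X,Y,Z)=\frac\alpha2\|XY^\top-Z\|_F^2$. Iteration $k=0,1,2,\dots$: 1. $Z^k=(\mathcal I-\frac{\beta}{\alpha+\beta}\mathcal A^*\mathcal A)(X^k(Y^k)^\top)+\frac{\beta}{\alpha+\beta}\mathcal A^*(b)$. 2. Choose any $\mu_k^0\ge\mu^{\min}$ and $\sigma_k^0\in[\sigma^{\min},\sigma^{\max}]$; set $\mu_k=\mu_k^0$, $\sigma_k=\sigma_k^0$, $\mu_k^{\max}=(\alpha+2\gamma\rho)\|Y^k\|^2+c$. (a) Set $\mu_k\leftarrow\min\{\mu_k,\mu_k^{\max}\}$ and compute $U$ by one of: a global minimizer over $X$ of $\Psi(X)+\mathcal H(X,Y^k,Z^k)+\frac\lambda2\|X-Y^k\|_F^2+\frac{\mu_k}2\|X-X^k\|_F^2$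 (proximal); the same with $\mathcal H(X,Y^k,Z^k)$ replaced by $\langle\nabla_X\mathcal H(X^k,Y^k,Z^k),X-X^k\rangle$ (prox-linear); or, if $\Psi(X)=\sum_i\psi_i(x_i)$ over the columns $x_i$, successively for $i=1,\dots,r$ a global minimizer $u_i$ over $x_i$ of $\psi_i(x_i)+\mathcal H([u_{j<i},x_i,x^k_{j>i}],Y^k,Z^k)+\frac\lambda2\|x_i-y_i^k\|^2+\frac{\mu_k}2\|x_i-x_i^k\|^2$ (hierarchical). (b) Compute $V$ by one of: a global minimizer over $Y$ of $\Phi(Y)+\mathcal H(U,Y,Z^k)+\frac\lambda2\|U-Y\|_F^2+\frac{\sigma_k}2\|Y-Y^k\|_F^2$; the same with $\mathcal H(U,Y,Z^k)$ replaced by $\langle\nabla_Y\mathcal H(U,Y^k,Z^k),Y-Y^k\rangle$; or, if $\Phi(Y)=\sum_i\phi_i(y_i)$, successively for $i=1,\dots,r$ a global minimizer $v_i$ over $y_i$ of $\phi_i(y_i)+\mathcal H(U,[v_{j<i},y_i,y^k_{j>i}],Z^k)+\frac\lambda2\|u_i-y_i\|^2+\frac{\sigma_k}2\|y_i-y_i^k\|^2$.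 (c) If $\mathcal F_\lambda(U,V)-\mathcal R_k\le-\frac c2(\|U-X^k\|_F^2+\|V-Y^k\|_F^2)$, go to 3. (d) If $\mu_k=\mu_k^{\max}$, set $\sigma_k\leftarrow\min\{\tau\sigma_k,\ (\alpha+2\gamma\rho)\|U\|^2+c\}$ and go to (b) (keeping $U$); otherwise set $\mu_k\leftarrow\tau\mu_k$, $\sigma_k\leftarrow\tau\sigma_k$ and go to (a). 3. $X^{k+1}=U$, $Y^{k+1}=V$; choose any $p_{k+1}\in[p_{\min},1]$ and set $\mathcal R_{k+1}=(1-p_{k+1})\mathcal R_k+p_{k+1}\mathcal F_\lambda(X^{k+1},Y^{k+1})$. The scheme in (a) and in (b) may be chosen anew each time it is executed. **Theorem.** Suppose that Assumption A holds and that $\mathcal F_\lambda$ is a KL function, and let $\{(X^k,Y^k)\}_{k\ge0}$ be an infinite sequence generated by A-NAUM. Then $\{(X^k,Y^k)\}$ converges to a stationary point of $\mathcal F_\lambda$, and $\sum_{k=0}^\infty\big(\|X^{k+1}-X^k\|_F+\|Y^{k+1}-Y^k\|_F\big)<\infty$. -/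

import Mathlib

open Filter Topology

noncomputable section

namespace ANAUM

/-! ### Variational analysis on a real inner product space -/

section Variational

variable {E : Type*} [NormedAddCommGroup E] [InnerProductSpace ℝ E]

/-- Proper, closed (lower semicontinuous) and bounded from below, for a function with values in
`ℝ ∪ {+∞}`; the bound from below excludes the value `⊥`. -/
structure ProperClosedBddBelow (h : E → EReal) : Prop where
  nonempty_dom : ∃ x, h x < ⊤
  lsc : LowerSemicontinuous h
  bddBelow : ∃ m : ℝ, ∀ x, (m : EReal) ≤ h x

/-- All sublevel sets at finite levels are bounded. -/
def LevelBounded (h : E → EReal) : Prop :=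
  ∀ t : ℝ, Bornology.IsBounded {x | h x ≤ (t : EReal)}

/-- Fréchet (regular) subdifferential: `x ∈ dom h` and
`h y ≥ h x + ⟨D, y - x⟩ + o(‖y - x‖)` as `y → x`. -/
def frechetSubdiff (h : E → EReal) (x : E) : Set E :=
  {D | h x < ⊤ ∧ ∀ ε : ℝ, 0 < ε → ∀ᶠ y in 𝓝 x,
    h x + ((inner ℝ D (y - x) - ε * ‖y - x‖ : ℝ) : EReal) ≤ h y}

/-- Limiting subdifferential: limits of regular subgradients `D k` at points `x k → x`
with `h (x k) → h x`; empty outside `dom h`. -/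
def limSubdiff (h : E → EReal) (x : E) : Set E :=
  {D | h x < ⊤ ∧ ∃ (xs Ds : ℕ → E),
    Tendsto xs atTop (𝓝 x) ∧ Tendsto (fun k => h (xs k)) atTop (𝓝 (h x)) ∧
    Tendsto Ds atTop (𝓝 D) ∧ ∀ k, Ds k ∈ frechetSubdiff h (xs k)}

/-- `x` is a stationary point of `h`. -/
def IsStationary (h : E → EReal) (x : E) : Prop := (0 : E) ∈ limSubdiff h x

/-- Desingularizing functions on `[0, ν)`, `ν ∈ (0, +∞]`. -/
structure IsDesingularizing (ν : EReal) (φ : ℝ → ℝ) : Prop where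
  concave : ConcaveOn ℝ {t : ℝ | 0 ≤ t ∧ (t : EReal) < ν} φ
  nonneg : ∀ t : ℝ, 0 ≤ t → (t : EReal) < ν → 0 ≤ φ t
  map_zero : φ 0 = 0
  contDiffOn : ContDiffOn ℝ 1 φ {t : ℝ | 0 < t ∧ (t : EReal) < ν}
  continuous_zero : ContinuousWithinAt φ {t : ℝ | 0 ≤ t ∧ (t : EReal) < ν} 0
  deriv_pos : ∀ t : ℝ, 0 < t → (t : EReal) < ν → 0 < deriv φ t

/-- Kurdyka–Łojasiewicz property of `h` at `x₀`.  The distance from `0` to the subdifferential is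
taken in `[0, ∞]`, so that it is `∞` when the subdifferential is empty. -/
def HasKLAt (h : E → EReal) (x₀ : E) : Prop :=
  ∃ ν : EReal, 0 < ν ∧ ∃ V ∈ 𝓝 x₀, ∃ φ : ℝ → ℝ, IsDesingularizing ν φ ∧
    ∀ x ∈ V, h x₀ < h x → h x < h x₀ + ν →
      1 ≤ ENNReal.ofReal (deriv φ (h x - h x₀).toReal) * Metric.infEDist 0 (limSubdiff h x)

/-- `h` is a KL function: it has the KL property at each point of `dom ∂h`. -/
def IsKLFunction (h : E → EReal) : Prop :=
  ∀ x₀ : E, (limSubdiff h x₀).Nonempty → HasKLAt h x₀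

end Variational

/-! ### Matrices with the Frobenius inner product -/

/-- Real `m × n` matrices; entries are indexed by pairs, so the Euclidean norm and inner product
are the Frobenius ones. -/
abbrev Mat (m n : ℕ) : Type := EuclideanSpace ℝ (Fin m × Fin n)

/-- The matrix with the entries of `X`. -/
def asMatrix {m n : ℕ} (X : Mat m n) : Matrix (Fin m) (Fin n) ℝ := Matrix.of fun i j => X (i, j)

/-- Inverse of `asMatrix`. -/
def ofMatrix {m n : ℕ} (M : Matrix (Fin m) (Fin n) ℝ) : Mat m n :=
  WithLp.toLp 2 fun p => M p.1 p.2

/-- `X Yᵀ`. -/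
def mulT {n r : ℕ} (X Y : Mat n r) : Mat n n := ofMatrix (asMatrix X * (asMatrix Y).transpose)

/-- Spectral norm (largest singular value). -/
def specNorm {m n : ℕ} (X : Mat m n) : ℝ :=
  ‖LinearMap.toContinuousLinearMap (Matrix.toEuclideanLin (asMatrix X))‖

/-- The `j`-th column. -/
def col {m n : ℕ} (X : Mat m n) (j : Fin n) : EuclideanSpace ℝ (Fin m) :=
  WithLp.toLp 2 fun i => X (i, j)

/-- The matrix with columns `U_j` for `j < i`, `x` for `j = i`, and `X_j` for `j > i`. -/
def mixCols {m n : ℕ} (U X : Mat m n) (i : Fin n) (x : EuclideanSpace ℝ (Fin m)) : Mat m n :=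
  WithLp.toLp 2 fun p => if p.2 < i then U p else if p.2 = i then x p.1 else X p

/-- Pairs `(X, Y)` of `n × r` matrices, with norm `(‖X‖_F² + ‖Y‖_F²)^(1/2)`. -/
abbrev MatPair (n r : ℕ) : Type := WithLp 2 (Mat n r × Mat n r)

/-- The pair `(X, Y)`. -/
def pair {n r : ℕ} (X Y : Mat n r) : MatPair n r := WithLp.toLp 2 (X, Y)

/-! ### The problem -/

/-- Data of the generalized symmetric matrix factorization problem. -/
structure GSMF (n r q : ℕ) where
  Ψ : Mat n r → EReal
  Φ : Mat n r → EReal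
  A : Mat n n →L[ℝ] EuclideanSpace ℝ (Fin q)
  b : EuclideanSpace ℝ (Fin q)
  lam : ℝ

variable {n r q : ℕ}

/-- The objective
`F(X, Y) = Ψ(X) + Φ(Y) + ½ ‖A(X Yᵀ) - b‖² + (lam / 2) ‖X - Y‖_F²`. -/
def GSMF.F (P : GSMF n r q) : MatPair n r → EReal := fun w =>
  P.Ψ w.fst + P.Φ w.snd +
    ((1 / 2 * ‖P.A (mulT w.fst w.snd) - P.b‖ ^ 2 + P.lam / 2 * ‖w.fst - w.snd‖ ^ 2 : ℝ) : EReal)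

/-- `A* A`. -/
def GSMF.gram (P : GSMF n r q) : Mat n n →L[ℝ] Mat n n :=
  (ContinuousLinearMap.adjoint P.A).comp P.A

/-- The standing assumptions.  Level-boundedness is assumed when `lam = 0`, and also when
`lam > 0` but `A(X Xᵀ)` vanishes at some `X ≠ 0`; in the remaining case it is automatic. -/
structure AssumptionA (P : GSMF n r q) (α β : ℝ) : Prop where
  lam_nonneg : 0 ≤ P.lam
  psi : ProperClosedBddBelow P.Ψ
  phi : ProperClosedBddBelow P.Φ
  coisometry : P.A.comp (ContinuousLinearMap.adjoint P.A) =
    ContinuousLinearMap.id ℝ (EuclideanSpace ℝ (Fin q))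
  alpha_ne_zero : α ≠ 0
  beta_ne_zero : β ≠ 0
  alpha_beta : 1 / α + 1 / β = 1
  levelBounded : (P.lam = 0 ∨ ∃ X : Mat n r, X ≠ 0 ∧ P.A (mulT X X) = 0) → LevelBounded P.F

/-! ### The algorithm -/

/-- Input parameters of the algorithm. -/
structure Params where
  α : ℝ
  β : ℝ
  γ : ℝ
  μmin : ℝ
  σmin : ℝ
  σmax : ℝ
  τ : ℝ
  c : ℝ
  pmin : ℝ

/-- Admissibility of the input parameters; the relation between `α` and `β` is part of
`AssumptionA`. -/
structure Params.Admissible (S : Params) (P : GSMF n r q) : Prop where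
  gamma_nonneg : 0 ≤ S.γ
  gamma_psd :
    ((S.α + S.γ) • ContinuousLinearMap.id ℝ (Mat n n) + S.β • P.gram).IsPositive
  mu_min_pos : 0 < S.μmin
  sigma_min_pos : 0 < S.σmin
  sigma_min_lt : S.σmin < S.σmax
  one_lt_tau : 1 < S.τ
  c_pos : 0 < S.c
  pmin_pos : 0 < S.pmin
  pmin_lt_one : S.pmin < 1

/-- `I - β / (α + β) A* A`. -/
def GSMF.relaxMap (P : GSMF n r q) (S : Params) : Mat n n →L[ℝ] Mat n n :=
  ContinuousLinearMap.id ℝ (Mat n n) - (S.β / (S.α + S.β)) • P.gram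

/-- `ρ = ‖I - β / (α + β) A* A‖²`. -/
def GSMF.rho (P : GSMF n r q) (S : Params) : ℝ := ‖P.relaxMap S‖ ^ 2

/-- The update of `Z`. -/
def GSMF.zUpdate (P : GSMF n r q) (S : Params) (X Y : Mat n r) : Mat n n :=
  P.relaxMap S (mulT X Y) + (S.β / (S.α + S.β)) • ContinuousLinearMap.adjoint P.A P.b

/-- `H(X, Y, Z) = (α / 2) ‖X Yᵀ - Z‖_F²`. -/
def H (α : ℝ) (X Y : Mat n r) (Z : Mat n n) : ℝ := α / 2 * ‖mulT X Y - Z‖ ^ 2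

/-- `u` is a global minimizer of `h`. -/
def IsArgmin {T : Type*} (h : T → EReal) (u : T) : Prop := ∀ x, h u ≤ h x

/-- `h(X) = ∑ᵢ hᵢ(xᵢ)` over the columns, with `hᵢ` valued in `ℝ ∪ {+∞}`. -/
def IsColSum (h : Mat n r → EReal) (hc : Fin r → EuclideanSpace ℝ (Fin n) → EReal) : Prop :=
  (∀ i x, hc i x ≠ ⊥) ∧ ∀ X, h X = ∑ i, hc i (col X i)

/-- Proximal update of the first block. -/
def GSMF.UProx (P : GSMF n r q) (α : ℝ) (X Y : Mat n r) (Z : Mat n n) (μ : ℝ) (U : Mat n r) :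
    Prop :=
  IsArgmin (fun W => P.Ψ W +
    ((H α W Y Z + P.lam / 2 * ‖W - Y‖ ^ 2 + μ / 2 * ‖W - X‖ ^ 2 : ℝ) : EReal)) U

/-- Prox-linear update of the first block. -/
def GSMF.UProxLinear (P : GSMF n r q) (α : ℝ) (X Y : Mat n r) (Z : Mat n n) (μ : ℝ)
    (U : Mat n r) : Prop :=
  IsArgmin (fun W => P.Ψ W +
    ((inner ℝ (gradient (fun W' => H α W' Y Z) X) (W - X) + P.lam / 2 * ‖W - Y‖ ^ 2
      + μ / 2 * ‖W - X‖ ^ 2 : ℝ) : EReal)) U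

/-- Hierarchical-prox (column by column) update of the first block; available only when `Ψ` is
column-wise separable. -/
def GSMF.UHier (P : GSMF n r q) (α : ℝ) (X Y : Mat n r) (Z : Mat n n) (μ : ℝ) (U : Mat n r) :
    Prop :=
  ∃ ψ, IsColSum P.Ψ ψ ∧ ∀ i, IsArgmin (fun x => ψ i x +
    ((H α (mixCols U X i x) Y Z + P.lam / 2 * ‖x - col Y i‖ ^ 2
      + μ / 2 * ‖x - col X i‖ ^ 2 : ℝ) : EReal)) (col U i)

/-- `U` is obtained by one of the three schemes. -/
def GSMF.UUpdate (P : GSMF n r q) (α : ℝ) (X Y : Mat n r) (Z : Mat n n) (μ : ℝ) (U : Mat n r) :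
    Prop :=
  P.UProx α X Y Z μ U ∨ P.UProxLinear α X Y Z μ U ∨ P.UHier α X Y Z μ U

/-- Proximal update of the second block. -/
def GSMF.VProx (P : GSMF n r q) (α : ℝ) (U Y : Mat n r) (Z : Mat n n) (σ : ℝ) (V : Mat n r) :
    Prop :=
  IsArgmin (fun W => P.Φ W +
    ((H α U W Z + P.lam / 2 * ‖U - W‖ ^ 2 + σ / 2 * ‖W - Y‖ ^ 2 : ℝ) : EReal)) V

/-- Prox-linear update of the second block. -/
def GSMF.VProxLinear (P : GSMF n r q) (α : ℝ) (U Y : Mat n r) (Z : Mat n n) (σ : ℝ)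
    (V : Mat n r) : Prop :=
  IsArgmin (fun W => P.Φ W +
    ((inner ℝ (gradient (fun W' => H α U W' Z) Y) (W - Y) + P.lam / 2 * ‖U - W‖ ^ 2
      + σ / 2 * ‖W - Y‖ ^ 2 : ℝ) : EReal)) V

/-- Hierarchical-prox (column by column) update of the second block; available only when `Φ` is
column-wise separable. -/
def GSMF.VHier (P : GSMF n r q) (α : ℝ) (U Y : Mat n r) (Z : Mat n n) (σ : ℝ) (V : Mat n r) :
    Prop :=
  ∃ φ, IsColSum P.Φ φ ∧ ∀ i, IsArgmin (fun y => φ i y +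
    ((H α U (mixCols V Y i y) Z + P.lam / 2 * ‖col U i - y‖ ^ 2
      + σ / 2 * ‖y - col Y i‖ ^ 2 : ℝ) : EReal)) (col V i)

/-- `V` is obtained by one of the three schemes. -/
def GSMF.VUpdate (P : GSMF n r q) (α : ℝ) (U Y : Mat n r) (Z : Mat n n) (σ : ℝ) (V : Mat n r) :
    Prop :=
  P.VProx α U Y Z σ V ∨ P.VProxLinear α U Y Z σ V ∨ P.VHier α U Y Z σ V

/-- The cap `(α + 2 γ ρ) ‖W‖² + c` on a proximal parameter (`W = Y` for `μ`, `W = U` for `σ`;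
spectral norm). -/
def GSMF.cap (P : GSMF n r q) (S : Params) (W : Mat n r) : ℝ :=
  (S.α + 2 * S.γ * P.rho S) * specNorm W ^ 2 + S.c

/-- The line search criterion
`F(U, V) - R ≤ -(c / 2) (‖U - X‖_F² + ‖V - Y‖_F²)`. -/
def GSMF.Accepts (P : GSMF n r q) (S : Params) (X Y : Mat n r) (R : ℝ) (U V : Mat n r) : Prop :=
  P.F (pair U V) - (R : EReal) ≤
    ((-(S.c / 2) * (‖U - X‖ ^ 2 + ‖V - Y‖ ^ 2) : ℝ) : EReal)

/-- `Trial P S X Y Z R μ₀ σ₀ μ σ U V`: in the line search started at `(X, Y)` with reference value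
`R` and initial parameters `μ₀, σ₀`, the candidate `(U, V)` is computed with the parameters
`μ, σ`, all earlier candidates having been rejected. -/
inductive Trial (P : GSMF n r q) (S : Params) (X Y : Mat n r) (Z : Mat n n) (R μ₀ σ₀ : ℝ) :
    ℝ → ℝ → Mat n r → Mat n r → Prop
  | start {U V : Mat n r}
      (hU : P.UUpdate S.α X Y Z (min μ₀ (P.cap S Y)) U)
      (hV : P.VUpdate S.α U Y Z σ₀ V) :
      Trial P S X Y Z R μ₀ σ₀ (min μ₀ (P.cap S Y)) σ₀ U V
  | retryV {μ σ : ℝ} {U V V' : Mat n r}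
      (hprev : Trial P S X Y Z R μ₀ σ₀ μ σ U V) (hrej : ¬ P.Accepts S X Y R U V)
      (hμ : μ = P.cap S Y)
      (hV : P.VUpdate S.α U Y Z (min (S.τ * σ) (P.cap S U)) V') :
      Trial P S X Y Z R μ₀ σ₀ μ (min (S.τ * σ) (P.cap S U)) U V'
  | retryUV {μ σ : ℝ} {U V U' V' : Mat n r}
      (hprev : Trial P S X Y Z R μ₀ σ₀ μ σ U V) (hrej : ¬ P.Accepts S X Y R U V)
      (hμ : μ ≠ P.cap S Y)
      (hU : P.UUpdate S.α X Y Z (min (S.τ * μ) (P.cap S Y)) U')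
      (hV : P.VUpdate S.α U' Y Z (S.τ * σ) V') :
      Trial P S X Y Z R μ₀ σ₀ (min (S.τ * μ) (P.cap S Y)) (S.τ * σ) U' V'

/-- `(X k, Y k)` is an infinite sequence of iterates of the algorithm, started in the effective
domain of the objective, with reference values `R k` and weights `p k`. -/
structure IsRun (P : GSMF n r q) (S : Params) (X Y : ℕ → Mat n r) (R p : ℕ → ℝ) : Prop where
  start_mem_dom : P.F (pair (X 0) (Y 0)) < ⊤
  ref_zero : R 0 = (P.F (pair (X 0) (Y 0))).toReal
  step : ∀ k, ∃ μ₀ σ₀ μ σ : ℝ, S.μmin ≤ μ₀ ∧ S.σmin ≤ σ₀ ∧ σ₀ ≤ S.σmax ∧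
    Trial P S (X k) (Y k) (P.zUpdate S (X k) (Y k)) (R k) μ₀ σ₀ μ σ (X (k + 1)) (Y (k + 1)) ∧
    P.Accepts S (X k) (Y k) (R k) (X (k + 1)) (Y (k + 1))
  weight : ∀ k, S.pmin ≤ p (k + 1) ∧ p (k + 1) ≤ 1
  ref_succ : ∀ k, R (k + 1) =
    (1 - p (k + 1)) * R k + p (k + 1) * (P.F (pair (X (k + 1)) (Y (k + 1)))).toReal

end ANAUM

end

/-! The acceptance test gives descent directly: each step `a k` satisfies `F(w (k+1)) ≤ R k - (c/2)
(a k)²`. Since `R` averages the objective values with weights at least `pmin`, it decreases by at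
least `(pmin c/2) (a k)²`, so `R` converges to some `ζ` and the steps tend to zero. The iterates
stay in a bounded sublevel set (`AssumptionA.levelBounded_F`), and the line search then keeps the
proximal parameters bounded (`Trial.bounds`, `IsRun.exists_updates`).

Every block update is a global minimization of a quadratically perturbed function. It therefore
yields a global subgradient inequality for `Ψ` or `Φ` with a quadratic error (`IsProxSubgradient`).
This one notion covers all three schemes and does two jobs. Combined with the gradient of the smooth
part it gives a regular subgradient of `F` of norm at most `C a k` at the new iterate
(`exists_subgradient_bound`); here the choice of `Z` turns the gradients of `H` into those of the
data term. It also makes the values of `Ψ` and `Φ` converge along convergent subsequences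
(`tendsto_of_isProxSubgradient`), so a cluster point is stationary and has value `ζ`.

The objective need not decrease and may fall below `ζ`, where the KL inequality is silent. With `r =
R k - ζ`, either the new value is below `r/2` above `ζ`, and averaging contracts `r` by a fixed
factor, or it is at least `r/2`, and KL applies. In both cases `a k` is bounded by the decrease of
`A φ(r/2) + B √r` (`step_le_of_desingularizing`). Telescoping, together with an argument trapping
the iterates near the cluster point, gives finite length and convergence
(`summable_and_tendsto_of_hasKLAt`). -/

noncomputable section
namespace ANAUM

/-! ### Quadratically relaxed global subgradients -/

section ProxSubgradient

variable {E : Type*} [NormedAddCommGroup E] [InnerProductSpace ℝ E]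

/-- Global subgradient inequality up to the quadratic term `K ‖w - u‖²`. -/
def IsProxSubgradient (h : E → EReal) (K : ℝ) (u D : E) : Prop :=
  ∀ w, h u + ((inner ℝ D (w - u) - K * ‖w - u‖ ^ 2 : ℝ) : EReal) ≤ h w

theorem add_coe_le_of_add_coe_le {x y : EReal} {a b c : ℝ}
    (h : x + (a : EReal) ≤ y + (b : EReal)) (hc : c ≤ a - b) : x + (c : EReal) ≤ y := by
  have h1 : x + (c : EReal) ≤ x + ((a - b : ℝ) : EReal) :=
    add_le_add le_rfl (by exact_mod_cast hc)
  have h2 : x + ((a - b : ℝ) : EReal) = (x + (a : EReal)) + ((-b : ℝ) : EReal) := by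
    rw [add_assoc, ← EReal.coe_add, sub_eq_add_neg]
  have h3 : (y + (b : EReal)) + ((-b : ℝ) : EReal) = y := by
    rw [add_assoc, ← EReal.coe_add]; simp
  rw [h2] at h1
  exact h1.trans ((add_le_add h le_rfl).trans h3.le)

theorem IsProxSubgradient.mono {h : E → EReal} {K K' : ℝ} {u D : E}
    (hD : IsProxSubgradient h K u D) (hK : K ≤ K') : IsProxSubgradient h K' u D := by
  intro w
  refine le_trans (add_le_add le_rfl ?_) (hD w)
  have : K * ‖w - u‖ ^ 2 ≤ K' * ‖w - u‖ ^ 2 := by gcongr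
  exact_mod_cast by linarith

/-- A quadratic majorant of `g` at `u`, with slope `-D`, is moved by minimality onto `h`. Global
minimality makes the resulting inequality hold for every `w`, not only near `u`. -/
theorem IsArgmin.isProxSubgradient {h : E → EReal} {g : E → ℝ} {K : ℝ} {u D : E}
    (hu : IsArgmin (fun w => h w + (g w : EReal)) u)
    (hg : ∀ w, g w ≤ g u - inner ℝ D (w - u) + K * ‖w - u‖ ^ 2) :
    IsProxSubgradient h K u D := fun w =>
  add_coe_le_of_add_coe_le (hu w) (by linarith [hg w])

/-- A quadratically relaxed subgradient plus the gradient of a smooth term is a regular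
subgradient of the sum. -/
theorem IsProxSubgradient.add_mem_frechetSubdiff {h : E → EReal} {g : E → ℝ} {K : ℝ}
    {x D G : E} (hD : IsProxSubgradient h K x D) (hfin : h x + (g x : EReal) < ⊤)
    (hg : HasFDerivAt g (innerSL ℝ G) x) :
    D + G ∈ frechetSubdiff (fun w => h w + (g w : EReal)) x := by
  refine ⟨hfin, fun ε hε => ?_⟩
  have h1 := hg.isLittleO.def (half_pos hε)
  -- Half of `ε` pays for the remainder of `g`, half for the quadratic error.
  have h2 : ∀ᶠ y in 𝓝 x, |K| * ‖y - x‖ ≤ ε / 2 := by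
    have : Tendsto (fun y => |K| * ‖y - x‖) (𝓝 x) (𝓝 (|K| * ‖x - x‖)) := by
      apply Continuous.tendsto; fun_prop
    simp only [sub_self, norm_zero, mul_zero] at this
    exact this.eventually_le_const (half_pos hε)
  filter_upwards [h1, h2] with y hy1 hy2
  have e1 : g x + inner ℝ G (y - x) - ε / 2 * ‖y - x‖ ≤ g y := by
    rw [Real.norm_eq_abs] at hy1
    have := (abs_le.1 hy1).1
    simp only [innerSL_apply_apply] at this
    linarith
  have e2 : K * ‖y - x‖ ^ 2 ≤ ε / 2 * ‖y - x‖ := by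
    calc K * ‖y - x‖ ^ 2 ≤ |K| * ‖y - x‖ ^ 2 := by gcongr; exact le_abs_self K
      _ = (|K| * ‖y - x‖) * ‖y - x‖ := by ring
      _ ≤ _ := by gcongr
  have e3 := add_le_add (hD y) (EReal.coe_le_coe_iff.2 e1)
  refine le_trans ?_ e3
  have e4 : h x + ((inner ℝ D (y - x) - K * ‖y - x‖ ^ 2 : ℝ) : EReal) +
      ((g x + inner ℝ G (y - x) - ε / 2 * ‖y - x‖ : ℝ) : EReal) =
      h x + (((inner ℝ D (y - x) - K * ‖y - x‖ ^ 2) +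
        (g x + inner ℝ G (y - x) - ε / 2 * ‖y - x‖) : ℝ) : EReal) := by
    rw [add_assoc, ← EReal.coe_add]
  have e5 : h x + (g x : EReal) + ((inner ℝ (D + G) (y - x) - ε * ‖y - x‖ : ℝ) : EReal) =
      h x + ((g x + (inner ℝ (D + G) (y - x) - ε * ‖y - x‖) : ℝ) : EReal) := by
    rw [add_assoc, ← EReal.coe_add]
  rw [e4, e5]
  refine add_le_add le_rfl ?_
  rw [inner_add_left]
  exact_mod_cast by linarith

/-- Along a convergent sequence with bounded values and bounded relaxed subgradients, a lower
semicontinuous function converges to its value at the limit. -/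
theorem tendsto_of_isProxSubgradient {h : E → EReal} (hlsc : LowerSemicontinuous h) {m C K : ℝ}
    (hm : ∀ x, (m : EReal) ≤ h x) {xs Ds : ℕ → E} {x : E} (hx : Tendsto xs atTop (𝓝 x))
    (hC : ∀ k, h (xs k) ≤ (C : EReal)) (hD : ∀ k, IsProxSubgradient h K (xs k) (Ds k))
    {M : ℝ} (hM : ∀ k, ‖Ds k‖ ≤ M) :
    h x ≤ (C : EReal) ∧ Tendsto (fun k => (h (xs k)).toReal) atTop (𝓝 (h x).toReal) := by
  have hxC : h x ≤ (C : EReal) :=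
    (hlsc.isClosed_preimage (C : EReal)).mem_of_tendsto hx (Eventually.of_forall hC)
  have hfin : ∀ y, h y ≤ (C : EReal) → ((h y).toReal : EReal) = h y := fun y hy =>
    EReal.coe_toReal (ne_top_of_le_ne_top (EReal.coe_ne_top C) hy)
      (ne_bot_of_le_ne_bot (EReal.coe_ne_bot m) (hm y))
  refine ⟨hxC, ?_⟩
  -- The inequality at `xs k`, tested at the limit `x`, bounds the values from above; lower
  -- semicontinuity supplies the other half.
  have hup : ∀ k, (h (xs k)).toReal ≤
      (h x).toReal + (M * ‖x - xs k‖ + K * ‖x - xs k‖ ^ 2) := by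
    intro k
    have h1 := hD k x
    rw [← hfin x hxC, ← hfin _ (hC k), ← EReal.coe_add, EReal.coe_le_coe_iff] at h1
    have h2 : -(M * ‖x - xs k‖) ≤ inner ℝ (Ds k) (x - xs k) := by
      have := (abs_le.1 (abs_real_inner_le_norm (Ds k) (x - xs k))).1
      have h3 : ‖Ds k‖ * ‖x - xs k‖ ≤ M * ‖x - xs k‖ := by gcongr; exact hM k
      linarith
    linarith
  have hlim : Tendsto (fun k => (h x).toReal + (M * ‖x - xs k‖ + K * ‖x - xs k‖ ^ 2)) atTop
      (𝓝 (h x).toReal) := by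
    have h0 : Tendsto (fun k => ‖x - xs k‖) atTop (𝓝 0) := by
      have := (tendsto_const_nhds (x := x)).sub hx
      simpa using this.norm
    simpa using ((h0.const_mul M).add ((h0.pow 2).const_mul K)).const_add (h x).toReal
  rw [tendsto_order]
  constructor
  · intro a ha
    have : (a : EReal) < h x := by rw [← hfin x hxC]; exact_mod_cast ha
    filter_upwards [hx.eventually (hlsc x a this)] with k hk
    rw [← hfin _ (hC k)] at hk
    exact_mod_cast hk
  · intro a ha
    filter_upwards [hlim.eventually_lt_const ha] with k hk
    exact (hup k).trans_lt hk

variable {F : Type*} [NormedAddCommGroup F] [InnerProductSpace ℝ F]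

theorem norm_sub_add_sq_expand (u w y : E) :
    ‖w - y‖ ^ 2 = ‖u - y‖ ^ 2 + 2 * inner ℝ (u - y) (w - u) + ‖w - u‖ ^ 2 := by
  rw [← norm_add_sq_real]; congr 2; abel

/-- Second-order expansion of the model functions minimized by the algorithm. -/
theorem quadratic_model_le [CompleteSpace E] [CompleteSpace F] (L : E →L[ℝ] F) (Z : F)
    (G a x y u : E) (α lam μ : ℝ) (w : E) :
    α / 2 * ‖L w - Z‖ ^ 2 + inner ℝ G (w - a) + lam / 2 * ‖w - y‖ ^ 2 + μ / 2 * ‖w - x‖ ^ 2 ≤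
      (α / 2 * ‖L u - Z‖ ^ 2 + inner ℝ G (u - a) + lam / 2 * ‖u - y‖ ^ 2 + μ / 2 * ‖u - x‖ ^ 2)
      - inner ℝ (-(α • ContinuousLinearMap.adjoint L (L u - Z) + G + lam • (u - y)
          + μ • (u - x))) (w - u)
      + (|α| / 2 * ‖L‖ ^ 2 + |lam| / 2 + |μ| / 2) * ‖w - u‖ ^ 2 := by
  have h1 : ‖L w - Z‖ ^ 2 = ‖L u - Z‖ ^ 2 + 2 * inner ℝ (L u - Z) (L (w - u)) +
      ‖L (w - u)‖ ^ 2 := by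
    rw [← norm_add_sq_real]; congr 2; rw [map_sub]; abel
  have h2 : inner ℝ G (w - a) = inner ℝ G (u - a) + inner ℝ G (w - u) := by
    rw [← inner_add_right]; congr 1; abel
  rw [h1, h2, norm_sub_add_sq_expand u w y, norm_sub_add_sq_expand u w x]
  simp only [inner_neg_left, inner_add_left, real_inner_smul_left,
    ContinuousLinearMap.adjoint_inner_left]
  have h3 : ‖L (w - u)‖ ^ 2 ≤ ‖L‖ ^ 2 * ‖w - u‖ ^ 2 := by
    rw [← mul_pow]; gcongr; exact L.le_opNorm _
  have h4 : α / 2 * ‖L (w - u)‖ ^ 2 ≤ |α| / 2 * (‖L‖ ^ 2 * ‖w - u‖ ^ 2) := by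
    have : α ≤ |α| := le_abs_self α
    calc α / 2 * ‖L (w - u)‖ ^ 2 ≤ |α| / 2 * ‖L (w - u)‖ ^ 2 := by gcongr
      _ ≤ _ := by gcongr
  have h5 : lam / 2 * ‖w - u‖ ^ 2 ≤ |lam| / 2 * ‖w - u‖ ^ 2 := by
    gcongr; exact le_abs_self _
  have h6 : μ / 2 * ‖w - u‖ ^ 2 ≤ |μ| / 2 * ‖w - u‖ ^ 2 := by
    gcongr; exact le_abs_self _
  linarith

theorem hasGradientAt_half_norm_sq [CompleteSpace E] [CompleteSpace F] (L : E →L[ℝ] F) (Z : F)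
    (α : ℝ) (x : E) :
    HasGradientAt (fun w => α / 2 * ‖L w - Z‖ ^ 2)
      (α • ContinuousLinearMap.adjoint L (L x - Z)) x := by
  rw [hasGradientAt_iff_hasFDerivAt]
  have h := ((L.hasFDerivAt (x := x)).sub_const Z).norm_sq.const_mul (α / 2)
  refine h.congr_fderiv ?_
  ext v
  simp [ContinuousLinearMap.adjoint_inner_left]
  ring

end ProxSubgradient

/-! ### The bilinear map `(X, Y) ↦ X Yᵀ`, transposition and columns -/

variable {m n r q : ℕ}

theorem mulT_apply (X Y : Mat n r) (p : Fin n × Fin n) :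
    mulT X Y p = ∑ j, X (p.1, j) * Y (p.2, j) := by
  simp [mulT, ofMatrix, asMatrix, Matrix.mul_apply]

/-- `X Yᵀ` as a continuous bilinear map. -/
def mulTL (n r : ℕ) : Mat n r →L[ℝ] Mat n r →L[ℝ] Mat n n :=
  (LinearMap.mk₂ ℝ mulT
    (fun X X' Y => by
      ext p; simp [mulT_apply, add_mul, Finset.sum_add_distrib])
    (fun c X Y => by
      ext p; simp [mulT_apply, Finset.mul_sum, mul_assoc])
    (fun X Y Y' => by
      ext p; simp [mulT_apply, mul_add, Finset.sum_add_distrib])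
    (fun c X Y => by
      ext p; simp [mulT_apply, Finset.mul_sum, mul_left_comm])).toContinuousBilinearMap

@[simp] theorem mulTL_apply (X Y : Mat n r) : mulTL n r X Y = mulT X Y := rfl

theorem norm_mulT_le (X Y : Mat n r) : ‖mulT X Y‖ ≤ ‖mulTL n r‖ * ‖X‖ * ‖Y‖ :=
  (mulTL n r).le_opNorm₂ X Y

/-- The operator `W ↦ W Yᵀ`. -/
def mulTRight (Y : Mat n r) : Mat n r →L[ℝ] Mat n n := (mulTL n r).flip Y

@[simp] theorem mulTRight_apply (Y W : Mat n r) : mulTRight Y W = mulT W Y := rfl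

theorem norm_mulTRight_le (Y : Mat n r) : ‖mulTRight Y‖ ≤ ‖mulTL n r‖ * ‖Y‖ := by
  refine ((mulTL n r).flip.le_opNorm Y).trans_eq ?_
  rw [ContinuousLinearMap.opNorm_flip]

theorem mulTRight_sub (Y Y' : Mat n r) : mulTRight (Y - Y') = mulTRight Y - mulTRight Y' :=
  map_sub (mulTL n r).flip Y Y'

theorem mulT_sub_left (X X' Y : Mat n r) : mulT (X - X') Y = mulT X Y - mulT X' Y :=
  map_sub (mulTRight Y) X X'

theorem mulT_sub_right (X Y Y' : Mat n r) : mulT X (Y - Y') = mulT X Y - mulT X Y' :=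
  map_sub (mulTL n r X) Y Y'

/-! ### Exchange of the two factors by transposition. -/

/-- Transposition of square matrices. -/
def transp (Z : Mat n n) : Mat n n := WithLp.toLp 2 fun p => Z (p.2, p.1)

@[simp] theorem transp_apply (Z : Mat n n) (p : Fin n × Fin n) : transp Z p = Z (p.2, p.1) := rfl

theorem transp_mulT (X Y : Mat n r) : transp (mulT X Y) = mulT Y X := by
  ext p; simp [mulT_apply, mul_comm]

theorem transp_sub (Z W : Mat n n) : transp (Z - W) = transp Z - transp W := by
  ext p; simp

theorem inner_transp (Z W : Mat n n) : inner ℝ (transp Z) (transp W) = inner ℝ Z W := by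
  simp only [PiLp.inner_apply, transp_apply]
  exact Fintype.sum_equiv (Equiv.prodComm _ _) _ _ (fun p => rfl)

theorem norm_transp (Z : Mat n n) : ‖transp Z‖ = ‖Z‖ := by
  rw [← sq_eq_sq₀ (norm_nonneg _) (norm_nonneg _), ← real_inner_self_eq_norm_sq,
    ← real_inner_self_eq_norm_sq, inner_transp]

theorem H_swap (α : ℝ) (X Y : Mat n r) (Z : Mat n n) : H α X Y Z = H α Y X (transp Z) := by
  rw [H, H, ← transp_mulT X Y, ← transp_sub, norm_transp]

theorem adjoint_mulTRight_transp (U : Mat n r) (Z : Mat n n) :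
    ContinuousLinearMap.adjoint (mulTRight U) (transp Z) =
      ContinuousLinearMap.adjoint (mulTL n r U) Z := by
  refine ext_inner_right ℝ fun W => ?_
  rw [ContinuousLinearMap.adjoint_inner_left, ContinuousLinearMap.adjoint_inner_left,
    mulTRight_apply, mulTL_apply, ← transp_mulT U W, inner_transp]

/-- Transposition is an isometry exchanging the factors of the product, so every estimate for the
first block applies to the second. -/
theorem GSMF.vUpdate_iff_uUpdate_transp (P : GSMF n r q) (α : ℝ) (U Y : Mat n r) (Z : Mat n n) (σ : ℝ)
    (V : Mat n r) :
    P.VUpdate α U Y Z σ V ↔ ({P with Ψ := P.Φ} : GSMF n r q).UUpdate α Y U (transp Z) σ V := by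
  simp only [GSMF.VUpdate, GSMF.UUpdate, GSMF.VProx, GSMF.UProx, GSMF.VProxLinear,
    GSMF.UProxLinear, GSMF.VHier, GSMF.UHier, H_swap α U, norm_sub_rev U, norm_sub_rev (col U _)]

/-! ### Columns and column replacement. -/

/-- The `j`-th column as a continuous linear map. -/
def colL (m n : ℕ) (j : Fin n) : Mat m n →L[ℝ] EuclideanSpace ℝ (Fin m) :=
  LinearMap.toContinuousLinearMap
    { toFun := fun X => col X j
      map_add' := fun X Y => by ext i; simp [col]
      map_smul' := fun c X => by ext i; simp [col] }

@[simp] theorem colL_apply (X : Mat m n) (j : Fin n) : colL m n j X = col X j := rfl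

@[simp] theorem col_apply (X : Mat m n) (j : Fin n) (i : Fin m) : col X j i = X (i, j) := rfl

/-- The matrix with columns `d j`. -/
def ofCols (d : Fin n → EuclideanSpace ℝ (Fin m)) : Mat m n := WithLp.toLp 2 fun p => d p.2 p.1

@[simp] theorem col_ofCols (d : Fin n → EuclideanSpace ℝ (Fin m)) (j : Fin n) :
    col (ofCols d) j = d j := rfl

theorem inner_eq_sum_col (X Y : Mat m n) : inner ℝ X Y = ∑ j, inner ℝ (col X j) (col Y j) := by
  simp only [PiLp.inner_apply, col_apply]
  rw [Fintype.sum_prod_type_right]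

theorem norm_sq_eq_sum_col (X : Mat m n) : ‖X‖ ^ 2 = ∑ j, ‖col X j‖ ^ 2 := by
  simp only [← real_inner_self_eq_norm_sq]
  exact inner_eq_sum_col X X

theorem norm_col_le (X : Mat m n) (j : Fin n) : ‖col X j‖ ≤ ‖X‖ := by
  refine (sq_le_sq₀ (norm_nonneg _) (norm_nonneg _)).1 ?_
  rw [norm_sq_eq_sum_col]
  exact Finset.single_le_sum (f := fun j => ‖col X j‖ ^ 2) (fun _ _ => sq_nonneg _)
    (Finset.mem_univ j)

theorem norm_le_of_norm_col_le (X : Mat m n) {c : ℝ} (hc : 0 ≤ c) (h : ∀ j, ‖col X j‖ ≤ c) :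
    ‖X‖ ≤ n * c := by
  refine (sq_le_sq₀ (norm_nonneg _) (by positivity)).1 ?_
  rw [norm_sq_eq_sum_col, mul_pow]
  calc ∑ j, ‖col X j‖ ^ 2 ≤ ∑ _j : Fin n, c ^ 2 :=
        Finset.sum_le_sum fun j _ => by gcongr; exact h j
    _ = n * c ^ 2 := by simp
    _ ≤ (n : ℝ) ^ 2 * c ^ 2 := by
        gcongr
        exact_mod_cast Nat.le_self_pow two_ne_zero n

/-- The adjoint of column extraction inserts a column among zeros. The mixed matrix is thus affine
in `x`, and each hierarchical subproblem again has a least-squares coupling term. -/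
theorem mixCols_eq (U X : Mat m n) (i : Fin n) (x : EuclideanSpace ℝ (Fin m)) :
    mixCols U X i x = mixCols U X i 0 + ContinuousLinearMap.adjoint (colL m n i) x := by
  rw [← sub_eq_iff_eq_add']
  refine ext_inner_right ℝ fun W => ?_
  rw [ContinuousLinearMap.adjoint_inner_left, colL_apply, inner_eq_sum_col,
    Finset.sum_eq_single i]
  · congr 1
    ext a
    simp [mixCols]
  · intro j _ hj
    have : col (mixCols U X i x - mixCols U X i 0) j = 0 := by
      ext a; simp [mixCols, hj]
    rw [this, inner_zero_left]
  · simp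

theorem norm_mixCols_sub_le (U X : Mat m n) (i : Fin n) :
    ‖mixCols U X i (col U i) - X‖ ≤ ‖U - X‖ := by
  refine (sq_le_sq₀ (norm_nonneg _) (norm_nonneg _)).1 ?_
  rw [EuclideanSpace.norm_sq_eq, EuclideanSpace.norm_sq_eq]
  refine Finset.sum_le_sum fun p _ => ?_
  rcases p with ⟨a, j⟩
  simp only [mixCols, PiLp.sub_apply, col_apply]
  split_ifs with h1 h2
  · exact le_rfl
  · subst h2; exact le_rfl
  · simp; positivity

/-! ### Relaxed subgradients produced by the block updates -/

theorem coe_sum_ereal {ι : Type*} (s : Finset ι) (f : ι → ℝ) :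
    ((∑ i ∈ s, f i : ℝ) : EReal) = ∑ i ∈ s, (f i : EReal) := by
  classical
  induction s using Finset.induction_on with
  | empty => simp
  | insert a s ha ih => rw [Finset.sum_insert ha, Finset.sum_insert ha, EReal.coe_add, ih]

/-- Inner product and squared norm both split over the columns, so the same `K` serves the sum. -/
theorem IsColSum.isProxSubgradient {h : Mat n r → EReal}
    {hc : Fin r → EuclideanSpace ℝ (Fin n) → EReal} (hsum : IsColSum h hc) {K : ℝ}
    {U D : Mat n r} (hD : ∀ i, IsProxSubgradient (hc i) K (col U i) (col D i)) :
    IsProxSubgradient h K U D := by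
  intro W
  have hcol : ∀ i, col (W - U) i = col W i - col U i := fun i => map_sub (colL n r i) W U
  have e : inner ℝ D (W - U) - K * ‖W - U‖ ^ 2 =
      ∑ i, (inner ℝ (col D i) (col W i - col U i) - K * ‖col W i - col U i‖ ^ 2) := by
    rw [inner_eq_sum_col, norm_sq_eq_sum_col, Finset.mul_sum, ← Finset.sum_sub_distrib]
    simp only [hcol]
  rw [e, coe_sum_ereal, hsum.2, hsum.2, ← Finset.sum_add_distrib]
  exact Finset.sum_le_sum fun i _ => hD i (col W i)

theorem norm_adjoint_mulTRight_le (Y : Mat n r) (T : Mat n n) :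
    ‖ContinuousLinearMap.adjoint (mulTRight Y) T‖ ≤ ‖mulTL n r‖ * ‖Y‖ * ‖T‖ := by
  refine (ContinuousLinearMap.le_opNorm _ _).trans ?_
  gcongr
  rw [LinearIsometryEquiv.norm_map]
  exact norm_mulTRight_le Y

theorem norm_mulT_adjoint_le (Y W : Mat n r) :
    ‖ContinuousLinearMap.adjoint (mulTRight Y) (mulT W Y)‖ ≤
      (‖mulTL n r‖ * ‖Y‖) ^ 2 * ‖W‖ := by
  refine (norm_adjoint_mulTRight_le Y _).trans ?_
  calc ‖mulTL n r‖ * ‖Y‖ * ‖mulT W Y‖ ≤ ‖mulTL n r‖ * ‖Y‖ * (‖mulTL n r‖ * ‖W‖ * ‖Y‖) := by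
        gcongr; exact norm_mulT_le W Y
    _ = _ := by ring

theorem norm_colL_le (i : Fin r) : ‖colL n r i‖ ≤ 1 :=
  ContinuousLinearMap.opNorm_le_bound _ zero_le_one fun X => by
    rw [one_mul]; exact norm_col_le X i

/-- `D` is minus the gradient of the smooth model at `U`. It is compared with the gradient of `H` at
the old point `X`, since that one can be rewritten through the residual at `(X, Y)`; the discrepancy
is of the order of the step. -/
theorem GSMF.UUpdate.exists_isProxSubgradient {P : GSMF n r q} {α μ : ℝ} {X Y U : Mat n r}
    {Z : Mat n n} (h : P.UUpdate α X Y Z μ U) :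
    ∃ D, IsProxSubgradient P.Ψ
        (|α| / 2 * (‖mulTL n r‖ * ‖Y‖) ^ 2 + |P.lam| / 2 + |μ| / 2) U D ∧
      ‖D + (α • ContinuousLinearMap.adjoint (mulTRight Y) (mulT X Y - Z) + P.lam • (U - Y))‖ ≤
        (r + 1) * ((|α| * (‖mulTL n r‖ * ‖Y‖) ^ 2 + |μ|) * ‖U - X‖) := by
  set b := ‖mulTL n r‖ * ‖Y‖ with hb
  have hLb : |α| / 2 * ‖mulTRight Y‖ ^ 2 ≤ |α| / 2 * b ^ 2 := by
    gcongr; exact norm_mulTRight_le Y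
  -- The factor `r + 1` serves all schemes: `r` for adding up column errors, `1` for the
  -- whole-matrix updates, also when `r = 0`.
  have hr : ∀ t : ℝ, 0 ≤ t → t ≤ (r + 1) * t := fun t ht => by
    have : (0 : ℝ) ≤ r * t := by positivity
    linarith
  rcases h with h | h | ⟨ψ, hsum, h⟩
  · refine ⟨-(α • ContinuousLinearMap.adjoint (mulTRight Y) (mulT U Y - Z)
      + P.lam • (U - Y) + μ • (U - X)),
      (IsArgmin.isProxSubgradient h fun w => ?_).mono
        (K := |α| / 2 * ‖mulTRight Y‖ ^ 2 + |P.lam| / 2 + |μ| / 2) (by linarith), ?_⟩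
    · simpa [H] using quadratic_model_le (mulTRight Y) Z 0 0 X Y U α P.lam μ w
    · have e : -(α • ContinuousLinearMap.adjoint (mulTRight Y) (mulT U Y - Z)
          + P.lam • (U - Y) + μ • (U - X)) +
          (α • ContinuousLinearMap.adjoint (mulTRight Y) (mulT X Y - Z) + P.lam • (U - Y)) =
          -(α • ContinuousLinearMap.adjoint (mulTRight Y) (mulT (U - X) Y) + μ • (U - X)) := by
        have : mulT U Y - Z = mulT (U - X) Y + (mulT X Y - Z) := by
          rw [mulT_sub_left]; abel
        rw [this, map_add]
        module
      rw [e, norm_neg]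
      refine le_trans ?_ (hr _ (by positivity))
      refine (norm_add_le _ _).trans ?_
      rw [norm_smul, norm_smul, Real.norm_eq_abs, Real.norm_eq_abs, add_mul, mul_assoc]
      gcongr
      exact norm_mulT_adjoint_le Y _
  · have hgrad : gradient (fun W' => H α W' Y Z) X =
        α • ContinuousLinearMap.adjoint (mulTRight Y) (mulT X Y - Z) :=
      (hasGradientAt_half_norm_sq (mulTRight Y) Z α X).gradient
    unfold GSMF.UProxLinear at h
    rw [hgrad] at h
    refine ⟨-(α • ContinuousLinearMap.adjoint (mulTRight Y) (mulT X Y - Z)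
      + P.lam • (U - Y) + μ • (U - X)),
      (IsArgmin.isProxSubgradient h fun w => ?_).mono
        (K := |P.lam| / 2 + |μ| / 2) (by
          have : 0 ≤ |α| / 2 * b ^ 2 := by positivity
          linarith), ?_⟩
    -- The coupling term is now linear: it enters through `G`, and the quadratic coefficient is `0`.
    · simpa using quadratic_model_le (mulTRight Y) Z
        (α • ContinuousLinearMap.adjoint (mulTRight Y) (mulT X Y - Z)) X X Y U 0 P.lam μ w
    · have e : -(α • ContinuousLinearMap.adjoint (mulTRight Y) (mulT X Y - Z)
          + P.lam • (U - Y) + μ • (U - X)) +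
          (α • ContinuousLinearMap.adjoint (mulTRight Y) (mulT X Y - Z) + P.lam • (U - Y)) =
          -(μ • (U - X)) := by module
      rw [e, norm_neg, norm_smul, Real.norm_eq_abs]
      refine le_trans ?_ (hr _ (by positivity))
      gcongr
      have : 0 ≤ |α| * b ^ 2 := by positivity
      linarith
  · set d : Fin r → EuclideanSpace ℝ (Fin n) := fun i =>
      -(α • col (ContinuousLinearMap.adjoint (mulTRight Y)
          (mulT (mixCols U X i (col U i)) Y - Z)) i
        + P.lam • (col U i - col Y i) + μ • (col U i - col X i)) with hd
    refine ⟨ofCols d, IsColSum.isProxSubgradient hsum fun i => ?_, ?_⟩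
    -- As a function of column `i` alone the coupling term is `α/2 ‖L x - Z'‖²`, and `‖L‖ ≤ b`
    -- because column extraction is a contraction.
    · set L := (mulTRight Y).comp (ContinuousLinearMap.adjoint (colL n r i)) with hL
      have hmix : ∀ x, mulT (mixCols U X i x) Y - Z =
          L x - (Z - mulT (mixCols U X i 0) Y) := fun x => by
        rw [mixCols_eq, ← mulTRight_apply, map_add, hL, mulTRight_apply,
          ContinuousLinearMap.comp_apply]
        abel
      have hadj : ∀ T, ContinuousLinearMap.adjoint L T =
          col (ContinuousLinearMap.adjoint (mulTRight Y) T) i := fun T => by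
        rw [hL, ContinuousLinearMap.adjoint_comp, ContinuousLinearMap.adjoint_adjoint]; rfl
      have hLn : ‖L‖ ≤ b := by
        refine (ContinuousLinearMap.opNorm_comp_le _ _).trans ?_
        rw [LinearIsometryEquiv.norm_map]
        refine (mul_le_of_le_one_right (norm_nonneg _) (norm_colL_le i)).trans ?_
        exact norm_mulTRight_le Y
      have hLn2 : |α| / 2 * ‖L‖ ^ 2 ≤ |α| / 2 * b ^ 2 := by gcongr
      refine (IsArgmin.isProxSubgradient (h i) fun w => ?_).mono
        (K := |α| / 2 * ‖L‖ ^ 2 + |P.lam| / 2 + |μ| / 2) (by linarith)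
      have := quadratic_model_le L (Z - mulT (mixCols U X i 0) Y) 0 0 (col X i) (col Y i)
        (col U i) α P.lam μ w
      simpa [H, hmix, hadj, hd, -map_sub] using this
    · rw [add_mul (r : ℝ) 1]
      refine (norm_le_of_norm_col_le _ (c := (|α| * b ^ 2 + |μ|) * ‖U - X‖) (by positivity)
        fun i => ?_).trans (le_add_of_nonneg_right (by positivity))
      -- The gradient for column `i` is taken at a matrix whose columns up to `i` are already new;
      -- its distance to `X` is at most `‖U - X‖`.
      have e : col (ofCols d + (α • ContinuousLinearMap.adjoint (mulTRight Y) (mulT X Y - Z)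
          + P.lam • (U - Y))) i =
          -(α • col (ContinuousLinearMap.adjoint (mulTRight Y)
            (mulT (mixCols U X i (col U i) - X) Y)) i + μ • col (U - X) i) := by
        have : mulT (mixCols U X i (col U i)) Y - Z =
            mulT (mixCols U X i (col U i) - X) Y + (mulT X Y - Z) := by
          rw [mulT_sub_left]; abel
        simp only [← colL_apply, map_add, map_smul, map_sub]
        simp only [colL_apply, col_ofCols, hd, this, map_add]
        simp only [← colL_apply, map_add, map_sub]
        module
      rw [e, norm_neg]
      refine (norm_add_le _ _).trans ?_
      rw [norm_smul, norm_smul, Real.norm_eq_abs, Real.norm_eq_abs, add_mul, mul_assoc]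
      gcongr
      · refine (norm_col_le _ _).trans ((norm_mulT_adjoint_le Y _).trans ?_)
        gcongr
        exact norm_mixCols_sub_le U X i
      · exact norm_col_le _ _

/-! ### Proximal parameters along the line search -/

theorem Trial.updates {P : GSMF n r q} {S : Params} {X Y : Mat n r} {Z : Mat n n}
    {R μ₀ σ₀ μ σ : ℝ} {U V : Mat n r} (h : Trial P S X Y Z R μ₀ σ₀ μ σ U V) :
    P.UUpdate S.α X Y Z μ U ∧ P.VUpdate S.α U Y Z σ V := by
  induction h with
  | start hU hV => exact ⟨hU, hV⟩
  | retryV hprev hrej hμ hV ih => exact ⟨ih.1, hV⟩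
  | retryUV hprev hrej hμ hU hV ih => exact ⟨hU, hV⟩

/-- Until `μ` reaches its cap, both parameters grow by the factor `τ`, so `σ/μ` stays at most `σmax
/ min μmin c`. The trial truncating `μ` still multiplies `σ` by `τ`, whence the extra `τ` in the
last clause; from then on `σ` is capped through `U`. -/
theorem Trial.bounds {P : GSMF n r q} {S : Params} {X Y : Mat n r} {Z : Mat n n}
    {R μ₀ σ₀ μ σ : ℝ} {U V : Mat n r} (hS : S.Admissible P) (hcap : ∀ W, S.c ≤ P.cap S W)
    (hμ₀ : S.μmin ≤ μ₀) (hσ₀ : S.σmin ≤ σ₀) (hσ₀' : σ₀ ≤ S.σmax)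
    (h : Trial P S X Y Z R μ₀ σ₀ μ σ U V) :
    min S.μmin S.c ≤ μ ∧ μ ≤ P.cap S Y ∧ 0 ≤ σ ∧
      (μ ≠ P.cap S Y → σ ≤ S.σmax / min S.μmin S.c * μ) ∧
      (σ ≤ S.τ * (S.σmax / min S.μmin S.c * P.cap S Y) ∨ σ ≤ P.cap S U) := by
  have hm : 0 < min S.μmin S.c := lt_min hS.mu_min_pos hS.c_pos
  have hσm : 0 < S.σmax := hS.sigma_min_pos.trans hS.sigma_min_lt
  have hτ := hS.one_lt_tau
  set K := S.σmax / min S.μmin S.c with hK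
  have hK0 : 0 < K := by positivity
  have hcap0 : ∀ W, 0 < P.cap S W := fun W => hS.c_pos.trans_le (hcap W)
  induction h with
  | start hU hV =>
    have h1 : min S.μmin S.c ≤ min μ₀ (P.cap S Y) := min_le_min hμ₀ (hcap Y)
    have h2 : σ₀ ≤ K * min μ₀ (P.cap S Y) := by
      calc σ₀ ≤ S.σmax := hσ₀'
        _ = K * min S.μmin S.c := by rw [hK]; field_simp
        _ ≤ _ := by gcongr
    have h3 : K * min μ₀ (P.cap S Y) ≤ K * P.cap S Y := by gcongr; exact min_le_right _ _
    refine ⟨h1, min_le_right _ _, hS.sigma_min_pos.le.trans hσ₀, fun _ => h2, Or.inl ?_⟩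
    exact (h2.trans h3).trans (le_mul_of_one_le_left (mul_pos hK0 (hcap0 Y)).le hτ.le)
  | retryV hprev hrej hμ hV ih =>
    obtain ⟨i1, i2, i3, i4, i5⟩ := ih
    exact ⟨i1, i2, le_min (by positivity) (hcap0 _).le, fun hne => absurd hμ hne,
      Or.inr (min_le_right _ _)⟩
  | @retryUV μ σ U V U' V' hprev hrej hμ hU hV ih =>
    obtain ⟨i1, i2, i3, i4, i5⟩ := ih
    have hμ0 : 0 < μ := hm.trans_le i1
    have hσ : S.τ * σ ≤ S.τ * (K * μ) := by gcongr; exact i4 hμ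
    refine ⟨le_min (i1.trans (le_mul_of_one_le_left hμ0.le hτ.le))
      ((min_le_right _ _).trans (hcap Y)), min_le_right _ _, by positivity, fun hne => ?_,
      Or.inl (hσ.trans (by gcongr))⟩
    rcases min_choice (S.τ * μ) (P.cap S Y) with h | h
    · rw [h]; linarith
    · exact absurd h hne

/-! ### Positivity and size of the caps. -/

theorem AssumptionA.ratio_eq {P : GSMF n r q} {α β : ℝ} (hA : AssumptionA P α β) :
    β / (α + β) = 1 / α := by
  have ha := hA.alpha_ne_zero
  have hb := hA.beta_ne_zero
  have h := hA.alpha_beta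
  field_simp at h
  rw [show α + β = α * β by linarith]
  field_simp

theorem GSMF.gram_apply (P : GSMF n r q) (W : Mat n n) :
    P.gram W = ContinuousLinearMap.adjoint P.A (P.A W) := rfl

theorem AssumptionA.map_adjoint {P : GSMF n r q} {α β : ℝ} (hA : AssumptionA P α β)
    (y : EuclideanSpace ℝ (Fin q)) : P.A (ContinuousLinearMap.adjoint P.A y) = y :=
  DFunLike.congr_fun hA.coisometry y

theorem GSMF.sq_le_rho_of_relaxMap_eq_smul {P : GSMF n r q} {S : Params} {v : Mat n n} (hv : v ≠ 0) {t : ℝ}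
    (ht : P.relaxMap S v = t • v) : t ^ 2 ≤ P.rho S := by
  have h1 := (P.relaxMap S).le_opNorm v
  rw [ht, norm_smul] at h1
  have h2 : ‖t‖ ≤ ‖P.relaxMap S‖ := le_of_mul_le_mul_right h1 (norm_pos_iff.2 hv)
  rw [GSMF.rho, ← sq_abs t, ← Real.norm_eq_abs]
  gcongr

theorem Params.Admissible.psd {P : GSMF n r q} {S : Params} (hS : S.Admissible P) (v : Mat n n) :
    0 ≤ (S.α + S.γ) * ‖v‖ ^ 2 + S.β * ‖P.A v‖ ^ 2 := by
  have h := hS.gamma_psd.inner_nonneg_left v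
  simpa [inner_add_left, real_inner_smul_left, GSMF.gram_apply,
    ContinuousLinearMap.adjoint_inner_left, real_inner_self_eq_norm_sq] using h

/-- Only `α < 0` is at issue. `relaxMap` is the identity on `ker A` and, as `A A* = I`, the scalar
`1 - 1/α = 1/β` on the range of `A*`; either `v` or `A* A v` is an eigenvector. On the kernel, `ρ ≥
1` and semidefiniteness gives `γ ≥ -α`. On the range, `1/β > 1`, so `ρ ≥ 1/β² ≥ 1/β`, while `γ ≥ -(α
+ β) = -αβ`; hence `γρ ≥ -α`. -/
theorem cap_coeff_nonneg {P : GSMF n r q} {S : Params} (hA : AssumptionA P S.α S.β)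
    (hS : S.Admissible P) (hn : ∃ v : Mat n n, v ≠ 0) : 0 ≤ S.α + 2 * S.γ * P.rho S := by
  have hγ := hS.gamma_nonneg
  rcases lt_or_ge S.α 0 with hα | hα
  swap
  · have : 0 ≤ P.rho S := sq_nonneg _
    positivity
  obtain ⟨v, hv⟩ := hn
  by_cases hAv : P.A v = 0
  · have h1 : P.relaxMap S v = (1 : ℝ) • v := by
      simp [GSMF.relaxMap, GSMF.gram_apply, hAv]
    have h2 := GSMF.sq_le_rho_of_relaxMap_eq_smul hv h1
    have h3 := hS.psd v
    rw [hAv] at h3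
    have hvp : 0 < ‖v‖ ^ 2 := by positivity
    have h4 : 0 ≤ S.α + S.γ := by
      simp only [norm_zero, ne_eq, OfNat.ofNat_ne_zero, not_false_eq_true, zero_pow, mul_zero,
        add_zero] at h3
      exact nonneg_of_mul_nonneg_left h3 hvp
    nlinarith
  · set w := ContinuousLinearMap.adjoint P.A (P.A v) with hw
    have hAw : P.A w = P.A v := hA.map_adjoint _
    have hw0 : w ≠ 0 := fun h => hAv (by rw [← hAw, h, map_zero])
    have hgw : P.gram w = w := by rw [GSMF.gram_apply, hAw]
    have hnw : ‖P.A w‖ ^ 2 = ‖w‖ ^ 2 := by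
      rw [← real_inner_self_eq_norm_sq, ← ContinuousLinearMap.adjoint_inner_left,
        ← GSMF.gram_apply, hgw, real_inner_self_eq_norm_sq]
    have hβ : 1 / S.β = 1 - 1 / S.α := by linarith [hA.alpha_beta]
    have h1 : P.relaxMap S w = (1 / S.β) • w := by
      rw [hβ]
      simp [GSMF.relaxMap, hgw, hA.ratio_eq, sub_smul]
    have h2 := GSMF.sq_le_rho_of_relaxMap_eq_smul hw0 h1
    have h3 := hS.psd w
    rw [hnw, ← add_mul] at h3
    have hwp : 0 < ‖w‖ ^ 2 := by positivity
    have h4 : 0 ≤ S.α + S.γ + S.β := nonneg_of_mul_nonneg_left h3 hwp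
    have h5 : 1 < 1 / S.β := by
      rw [hβ]; linarith [one_div_neg.2 hα]
    have hb0 : 0 < S.β := one_div_pos.1 (zero_lt_one.trans h5)
    have h6 : S.α + S.β = S.α * S.β := by
      have ha := hA.alpha_ne_zero
      have hb := hA.beta_ne_zero
      have h := hA.alpha_beta
      field_simp at h
      linarith
    have h7 : -(S.α * S.β) ≤ S.γ := by linarith
    have h8 : 1 / S.β ≤ P.rho S := by nlinarith
    have h9 : -(S.α * S.β) * (1 / S.β) ≤ S.γ * P.rho S := by
      apply mul_le_mul h7 h8 (by positivity) hγ
    have h10 : -(S.α * S.β) * (1 / S.β) = -S.α := by field_simp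
    linarith

/-- The matrix as a continuous linear operator between Euclidean spaces. -/
def toOperator (m n : ℕ) :
    Mat m n →L[ℝ] EuclideanSpace ℝ (Fin n) →L[ℝ] EuclideanSpace ℝ (Fin m) :=
  LinearMap.toContinuousLinearMap
    { toFun := fun X => LinearMap.toContinuousLinearMap (Matrix.toEuclideanLin (asMatrix X))
      map_add' := fun X Y => by
        rw [← map_add, ← map_add]; rfl
      map_smul' := fun c X => by
        rw [RingHom.id_apply, ← map_smul, ← map_smul]; rfl }

theorem specNorm_le {m n : ℕ} (X : Mat m n) : specNorm X ≤ ‖toOperator m n‖ * ‖X‖ :=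
  (toOperator m n).le_opNorm X

/-- This keeps the truncated `μ` at least `min μmin c`. For `n = 0` the coefficient may be negative,
but the spectral norm vanishes. -/
theorem c_le_cap {P : GSMF n r q} {S : Params} (hA : AssumptionA P S.α S.β)
    (hS : S.Admissible P) (W : Mat n r) : S.c ≤ P.cap S W := by
  rw [GSMF.cap]
  rcases Nat.eq_zero_or_pos n with rfl | hn
  · have : specNorm W = 0 := by
      have h := specNorm_le W
      rw [Subsingleton.elim W 0, norm_zero, mul_zero] at h
      rw [Subsingleton.elim W 0]
      exact le_antisymm h (norm_nonneg _)
    simp [this]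
  · have : Nonempty (Fin n) := ⟨⟨0, hn⟩⟩
    have := cap_coeff_nonneg hA hS (exists_ne 0)
    exact le_add_of_nonneg_left (by positivity)

theorem cap_le {P : GSMF n r q} {S : Params} {M : ℝ} {W : Mat n r} (hW : ‖W‖ ≤ M) :
    P.cap S W ≤ |S.α + 2 * S.γ * P.rho S| * (‖toOperator n r‖ * M) ^ 2 + S.c := by
  rw [GSMF.cap]
  gcongr
  · exact le_abs_self _
  · exact norm_nonneg _
  · exact (specNorm_le W).trans (by gcongr)

/-! ### The smooth part of the objective -/

/-- The smooth part of the objective. -/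
def GSMF.smooth (P : GSMF n r q) (w : MatPair n r) : ℝ :=
  1 / 2 * ‖P.A (mulT w.fst w.snd) - P.b‖ ^ 2 + P.lam / 2 * ‖w.fst - w.snd‖ ^ 2

/-- `A* (A (X Yᵀ) - b)`. -/
def GSMF.residual (P : GSMF n r q) (X Y : Mat n r) : Mat n n :=
  ContinuousLinearMap.adjoint P.A (P.A (mulT X Y) - P.b)

/-- The gradient of the smooth part of the objective. -/
def GSMF.smoothGrad (P : GSMF n r q) (U V : Mat n r) : MatPair n r :=
  pair (ContinuousLinearMap.adjoint (mulTRight V) (P.residual U V) + P.lam • (U - V))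
    (ContinuousLinearMap.adjoint (mulTL n r U) (P.residual U V) + P.lam • (V - U))

@[simp] theorem pair_fst (U V : Mat n r) : (pair U V).fst = U := rfl

@[simp] theorem pair_snd (U V : Mat n r) : (pair U V).snd = V := rfl

theorem inner_pair (a b : MatPair n r) :
    inner ℝ a b = inner ℝ a.fst b.fst + inner ℝ a.snd b.snd := WithLp.prod_inner_apply a b

theorem hasFDerivAt_smooth (P : GSMF n r q) (U V : Mat n r) :
    HasFDerivAt P.smooth (innerSL ℝ (P.smoothGrad U V)) (pair U V) := by
  have h1 : HasFDerivAt (fun w : MatPair n r => w.fst) (WithLp.fstL 2 ℝ (Mat n r) (Mat n r))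
    (pair U V) := (WithLp.fstL 2 ℝ (Mat n r) (Mat n r)).hasFDerivAt
  have h2 : HasFDerivAt (fun w : MatPair n r => w.snd) (WithLp.sndL 2 ℝ (Mat n r) (Mat n r))
    (pair U V) := (WithLp.sndL 2 ℝ (Mat n r) (Mat n r)).hasFDerivAt
  have h3 := (mulTL n r).hasFDerivAt_of_bilinear h1 h2
  have h4 := ((P.A.hasFDerivAt.comp _ h3).sub_const P.b).norm_sq.const_mul (1 / 2)
  have h5 := (h1.sub h2).norm_sq.const_mul (P.lam / 2)
  refine (h4.add h5).congr_fderiv ?_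
  ext v
  simp only [innerSL_apply_apply, inner_pair, GSMF.smoothGrad, pair_fst, pair_snd, inner_add_left,
    ContinuousLinearMap.adjoint_inner_left, GSMF.residual, real_inner_smul_left,
    mulTRight_apply, mulTL_apply]
  simp [ContinuousLinearMap.precompR_apply, inner_sub_left]
  ring

/-- Since `β/(α+β) = 1/α`, the update is `Z = XYᵀ - (1/α) A*(A(XYᵀ) - b)`. The partial gradients of
`H` at `(X, Y, Z)` are therefore those of the data term. -/
theorem AssumptionA.smul_mulT_sub_zUpdate {P : GSMF n r q} {S : Params}
    (hA : AssumptionA P S.α S.β) (X Y : Mat n r) :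
    S.α • (mulT X Y - P.zUpdate S X Y) = P.residual X Y := by
  have ha := hA.alpha_ne_zero
  simp only [GSMF.zUpdate, GSMF.relaxMap, hA.ratio_eq, GSMF.residual, map_sub,
    sub_apply, smul_apply, ContinuousLinearMap.id_apply,
    GSMF.gram_apply]
  rw [show ∀ (a x y : Mat n n) (t : ℝ), a - (a - t • x + t • y) = t • (x - y) by
    intros; module, smul_smul, mul_one_div_cancel ha, one_smul]

/-! ### Convergence of averaged nonmonotone descent sequences under the KL property -/

/-- By concavity the slope at `s` is at most that of any chord to its left. The chord need not end
at `s`, which is what the nonmonotone setting requires. -/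
theorem IsDesingularizing.deriv_mul_le {ν : EReal} {φ : ℝ → ℝ} (h : IsDesingularizing ν φ)
    {s t t' : ℝ} (ht' : 0 ≤ t') (htt : t' ≤ t) (hts : t ≤ s) (hs : 0 < s) (hsν : (s : EReal) < ν) :
    deriv φ s * (t - t') ≤ φ t - φ t' := by
  have hmem : ∀ x, 0 ≤ x → x ≤ s → x ∈ {t : ℝ | 0 ≤ t ∧ (t : EReal) < ν} := fun x h0 hx =>
    ⟨h0, lt_of_le_of_lt (by exact_mod_cast hx) hsν⟩
  rcases htt.eq_or_lt with rfl | htt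
  · simp
  have hopen : IsOpen {t : ℝ | 0 < t ∧ (t : EReal) < ν} :=
    isOpen_Ioi.inter (isOpen_Iio.preimage continuous_coe_real_ereal)
  have hdiff : DifferentiableAt ℝ φ s :=
    (h.contDiffOn.differentiableOn one_ne_zero).differentiableAt (hopen.mem_nhds ⟨hs, hsν⟩)
  have key : deriv φ s ≤ (φ t - φ t') / (t - t') := by
    rcases hts.eq_or_lt with rfl | hts
    · have := h.concave.deriv_le_slope (hmem t' ht' htt.le) (hmem t hs.le le_rfl) htt hdiff
      rwa [slope_def_field] at this
    · have h1 := h.concave.deriv_le_slope (hmem t (ht'.trans htt.le) hts.le)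
        (hmem s hs.le le_rfl) hts hdiff
      rw [slope_def_field] at h1
      exact h1.trans (h.concave.slope_anti_adjacent (hmem t' ht' (htt.le.trans hts.le))
        (hmem s hs.le le_rfl) htt hts)
  rwa [le_div_iff₀ (sub_pos.2 htt)] at key

theorem IsDesingularizing.mono {ν : EReal} {φ : ℝ → ℝ} (h : IsDesingularizing ν φ)
    {t t' : ℝ} (ht' : 0 ≤ t') (htt : t' ≤ t) (htν : (t : EReal) < ν) : φ t' ≤ φ t := by
  rcases (ht'.trans htt).eq_or_lt with h0 | h0
  · have : t' = t := by linarith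
    rw [this]
  · have h1 := h.deriv_mul_le ht' htt le_rfl h0 htν
    have h2 := h.deriv_pos t h0 htν
    nlinarith

/-- One step of an averaged descent method is controlled by the decrease of
`φ (x / 2) + √x` along the (shifted) reference values. -/
theorem step_le_of_desingularizing {ν : EReal} {φ : ℝ → ℝ} (h : IsDesingularizing ν φ)
    {r r' f a p pmin c C : ℝ} (hpm : 0 < pmin) (hp : pmin ≤ p) (hc : 0 < c)
    (hC : 0 ≤ C) (ha : 0 ≤ a) (hr' : 0 ≤ r') (hrν : (r : EReal) < ν)
    (hrec : r' = (1 - p) * r + p * f) (hdesc : f ≤ r - c / 2 * a ^ 2)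
    (hKL : 0 < f → 1 ≤ deriv φ f * (C * a)) :
    a ≤ (4 * C / (pmin * c)) * (φ (r / 2) - φ (r' / 2)) +
      (4 / pmin * √(2 / (pmin * c))) * (√r - √r') := by
  have hfr : f ≤ r := hdesc.trans (by nlinarith [sq_nonneg a])
  have hdec : pmin * c / 2 * a ^ 2 ≤ r - r' := by
    have : r - r' = p * (r - f) := by rw [hrec]; ring
    rw [this]
    calc pmin * c / 2 * a ^ 2 = pmin * (c / 2 * a ^ 2) := by ring
      _ ≤ p * (r - f) := by
        apply mul_le_mul hp (by linarith) (by positivity) (by linarith)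
  have hrr : r' ≤ r := by
    have : 0 ≤ pmin * c / 2 * a ^ 2 := by positivity
    linarith
  have hr : 0 ≤ r := hr'.trans hrr
  have hsqrt : √r' ≤ √r := Real.sqrt_le_sqrt hrr
  have hφ : φ (r' / 2) ≤ φ (r / 2) := by
    refine h.mono (by linarith) (by linarith) (lt_of_le_of_lt ?_ hrν)
    exact_mod_cast (by linarith : r / 2 ≤ r)
  have hs1 : 0 ≤ (4 * C / (pmin * c)) * (φ (r / 2) - φ (r' / 2)) :=
    mul_nonneg (by positivity) (by linarith)
  have hs2 : 0 ≤ (4 / pmin * √(2 / (pmin * c))) * (√r - √r') :=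
    mul_nonneg (by positivity) (by linarith)
  -- Either averaging with a small new value contracts the reference, or `f` is large enough for the
  -- KL inequality.
  rcases lt_or_ge f (r / 2) with hf | hf
  · refine le_trans ?_ (le_add_of_nonneg_left hs1)
    -- If `r = 0` then `f < 0`, and averaging would give `r' < 0`.
    have hr0 : 0 < r := by
      rcases hr.eq_or_lt with h0 | h0
      · have : 0 < p * (r - f) := mul_pos (hpm.trans_le hp) (by linarith)
        nlinarith
      · exact h0
    have hsr : 0 < √r := Real.sqrt_pos.2 hr0
    have h1 : a ≤ √(2 / (pmin * c)) * √r := by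
      rw [← Real.sqrt_mul (by positivity)]
      apply Real.le_sqrt_of_sq_le
      rw [div_mul_eq_mul_div, le_div_iff₀ (by positivity)]
      linarith
    -- The reference loses at least the fraction `pmin/2`; dividing by `√r + √r' ≤ 2√r` gives
    -- `pmin/4`.
    have h2 : pmin / 4 * √r ≤ √r - √r' := by
      have e1 : pmin / 2 * r ≤ r - r' := by
        have : r - r' = p * (r - f) := by rw [hrec]; ring
        rw [this]; nlinarith
      have e2 : r - r' = (√r - √r') * (√r + √r') := by
        nlinarith [Real.sq_sqrt hr, Real.sq_sqrt hr']
      have e3 : (√r - √r') * (√r + √r') ≤ (√r - √r') * (2 * √r) := by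
        gcongr
        linarith
      have e4 : (pmin / 4 * √r) * (2 * √r) ≤ (√r - √r') * (2 * √r) := by
        have : (pmin / 4 * √r) * (2 * √r) = pmin / 2 * r := by
          nlinarith [Real.sq_sqrt hr]
        linarith
      exact le_of_mul_le_mul_right e4 (by positivity)
    calc a ≤ √(2 / (pmin * c)) * √r := h1
      _ = (4 / pmin * √(2 / (pmin * c))) * (pmin / 4 * √r) := by field_simp
      _ ≤ _ := by gcongr
  · refine le_trans ?_ (le_add_of_nonneg_right hs2)
    rcases hr.eq_or_lt with hr0 | hr0
    · have : a = 0 := by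
        have : pmin * c / 2 * a ^ 2 ≤ 0 := by linarith
        by_contra hne
        have : 0 < pmin * c / 2 * a ^ 2 := by positivity
        linarith
      rw [this]; exact this ▸ hs1
    · have hf0 : 0 < f := by linarith
      have hk := hKL hf0
      have ha0 : 0 < a := by
        rcases ha.eq_or_lt with h0 | h0
        · rw [← h0] at hk; simp at hk; linarith
        · exact h0
      -- The reference `r` may exceed `f`; halving puts the chord to the left of `f`.
      have h1 := h.deriv_mul_le (s := f) (t := r / 2) (t' := r' / 2) (by linarith)
        (by linarith) hf hf0 (lt_of_le_of_lt (by exact_mod_cast hfr) hrν)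
      have h2 : (r / 2 - r' / 2) ≤ (φ (r / 2) - φ (r' / 2)) * (C * a) := by
        calc r / 2 - r' / 2 ≤ (r / 2 - r' / 2) * (deriv φ f * (C * a)) :=
              le_mul_of_one_le_right (by linarith) hk
          _ = deriv φ f * (r / 2 - r' / 2) * (C * a) := by ring
          _ ≤ _ := by gcongr
      rw [div_mul_eq_mul_div, le_div_iff₀ (by positivity)]
      -- The subgradient at the new point is controlled by the same step `a`, so one factor `a`
      -- cancels and the bound telescopes.
      have h3 : (a * (pmin * c)) * a ≤ (4 * C * (φ (r / 2) - φ (r' / 2))) * a := by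
        nlinarith
      exact le_of_mul_le_mul_right h3 ha0

/-- The reference values of an averaged descent method decrease sufficiently. -/
theorem sq_le_sub_of_averaged_descent {f R p a : ℕ → ℝ} {pmin c : ℝ} (hc : 0 < c)
    (hdesc : ∀ k, f (k + 1) ≤ R k - c / 2 * a k ^ 2)
    (hpm : 0 < pmin) (hp : ∀ k, pmin ≤ p (k + 1))
    (hR : ∀ k, R (k + 1) = (1 - p (k + 1)) * R k + p (k + 1) * f (k + 1)) (k : ℕ) :
    pmin * c / 2 * a k ^ 2 ≤ R k - R (k + 1) := by
  have h1 : R k - R (k + 1) = p (k + 1) * (R k - f (k + 1)) := by rw [hR]; ring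
  rw [h1]
  have := hdesc k
  have h2 : 0 ≤ c / 2 * a k ^ 2 := by positivity
  calc pmin * c / 2 * a k ^ 2 = pmin * (c / 2 * a k ^ 2) := by ring
    _ ≤ p (k + 1) * (R k - f (k + 1)) := by
      apply mul_le_mul (hp k) (by linarith) h2 (by linarith [hp k])

theorem tendsto_zero_of_sq_le_sub {R a : ℕ → ℝ} {κ ζ : ℝ} (hκ : 0 < κ) (ha : ∀ k, 0 ≤ a k)
    (h : ∀ k, κ * a k ^ 2 ≤ R k - R (k + 1)) (hR : Tendsto R atTop (𝓝 ζ)) :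
    Tendsto a atTop (𝓝 0) := by
  have h1 : Tendsto (fun k => √((R k - R (k + 1)) / κ)) atTop (𝓝 0) := by
    have := ((hR.sub (hR.comp (tendsto_add_atTop_nat 1))).div_const κ).sqrt
    simpa using this
  refine squeeze_zero ha (fun k => ?_) h1
  apply Real.le_sqrt_of_sq_le
  rw [le_div_iff₀ hκ]
  linarith [h k]

section

variable {E : Type*} [NormedAddCommGroup E] [InnerProductSpace ℝ E]

/-- An averaged nonmonotone descent sequence with a relative error condition converges, with
finite length, to any cluster point at which the KL property holds and the objective has the
limiting value. -/
theorem summable_and_tendsto_of_hasKLAt {F : E → EReal} {w : ℕ → E} {wbar : E}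
    {f R p : ℕ → ℝ} {ζ pmin c C : ℝ} (hpm : 0 < pmin) (hc : 0 < c) (hC : 0 ≤ C)
    (hf : ∀ k, F (w (k + 1)) = (f (k + 1) : EReal)) (hζ : F wbar = (ζ : EReal))
    (hKL : HasKLAt F wbar)
    (hsd : ∀ k, ∃ D ∈ limSubdiff F (w (k + 1)), ‖D‖ ≤ C * ‖w (k + 1) - w k‖)
    (hdesc : ∀ k, f (k + 1) ≤ R k - c / 2 * ‖w (k + 1) - w k‖ ^ 2)
    (hp : ∀ k, pmin ≤ p (k + 1) ∧ p (k + 1) ≤ 1)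
    (hR : ∀ k, R (k + 1) = (1 - p (k + 1)) * R k + p (k + 1) * f (k + 1))
    (hRlim : Tendsto R atTop (𝓝 ζ)) {ks : ℕ → ℕ} (hks : Tendsto ks atTop atTop)
    (hcl : Tendsto (fun j => w (ks j)) atTop (𝓝 wbar)) :
    Summable (fun k => ‖w (k + 1) - w k‖) ∧ Tendsto w atTop (𝓝 wbar) := by
  obtain ⟨ν, hν, V, hV, φ, hφ, hkl⟩ := hKL
  obtain ⟨δ, hδ, hball⟩ := Metric.mem_nhds_iff.1 hV
  set a : ℕ → ℝ := fun k => ‖w (k + 1) - w k‖ with ha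
  have hdec : ∀ k, pmin * c / 2 * a k ^ 2 ≤ R k - R (k + 1) :=
    sq_le_sub_of_averaged_descent hc hdesc hpm (fun k => (hp k).1) hR
  have hanti : Antitone R := antitone_nat_of_succ_le fun k => by
    have := hdec k
    have h2 : 0 ≤ pmin * c / 2 * a k ^ 2 := by positivity
    linarith
  have hRζ : ∀ k, ζ ≤ R k := fun k => hanti.le_of_tendsto hRlim k
  have hr0 : Tendsto (fun k => R k - ζ) atTop (𝓝 0) := by
    simpa using hRlim.sub_const ζ
  have ha0 : Tendsto a atTop (𝓝 0) :=
    tendsto_zero_of_sq_le_sub (by positivity) (fun k => norm_nonneg _) hdec hRlim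
  set A := 4 * C / (pmin * c)
  set B := 4 / pmin * √(2 / (pmin * c))
  have hA : 0 ≤ A := by positivity
  have hB : 0 ≤ B := by positivity
  set χ : ℕ → ℝ := fun k => A * φ ((R k - ζ) / 2) + B * √(R k - ζ) with hχ
  obtain ⟨ν0, hν0, hνν⟩ := EReal.lt_iff_exists_real_btwn.1 hν
  have hν0' : (0 : ℝ) < ν0 := by exact_mod_cast hν0
  have hsmall : ∀ᶠ k in atTop, R k - ζ < ν0 := hr0.eventually_lt_const hν0'
  have hχ0 : Tendsto χ atTop (𝓝 0) := by
    have h1 : Tendsto (fun k => (R k - ζ) / 2) atTop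
        (𝓝[{t : ℝ | 0 ≤ t ∧ (t : EReal) < ν}] 0) := by
      rw [tendsto_nhdsWithin_iff]
      refine ⟨by simpa using hr0.div_const 2, ?_⟩
      filter_upwards [hsmall] with k hk
      have := hRζ k
      refine ⟨by linarith, lt_trans ?_ hνν⟩
      exact_mod_cast by linarith
    have h2 := hφ.continuous_zero.tendsto.comp h1
    rw [hφ.map_zero] at h2
    simpa using (h2.const_mul A).add (hr0.sqrt.const_mul B)
  -- KL is used at the new iterate, so it is `w (k + 1)` that must lie in the ball, and only when `f
  -- (k + 1) > ζ`.
  have hstep : ∀ k, R k - ζ < ν0 → w (k + 1) ∈ Metric.ball wbar δ → a k ≤ χ k - χ (k + 1) := by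
    intro k hk hmem
    have hkν : ((R k - ζ : ℝ) : EReal) < ν := lt_trans (by exact_mod_cast hk) hνν
    have := step_le_of_desingularizing hφ (r := R k - ζ) (r' := R (k + 1) - ζ)
      (f := f (k + 1) - ζ) (a := a k) (p := p (k + 1)) (pmin := pmin) (c := c) (C := C)
      hpm (hp k).1 hc hC (norm_nonneg _) (by linarith [hRζ (k + 1)]) hkν
      (by rw [hR]; ring) (by linarith [hdesc k]) (fun hpos => ?_)
    · simp only [hχ]; linarith
    · have hfR : f (k + 1) ≤ R k := by
        have := hdesc k
        have h2 : 0 ≤ c / 2 * a k ^ 2 := by positivity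
        linarith
      have hfν : ((f (k + 1) - ζ : ℝ) : EReal) < ν :=
        lt_of_le_of_lt (by exact_mod_cast (by linarith : f (k + 1) - ζ ≤ R k - ζ)) hkν
      have h1 := hkl (w (k + 1)) (hball hmem)
      rw [hf, hζ, ← EReal.coe_sub, EReal.toReal_coe] at h1
      have h2 := h1 (by exact_mod_cast (by linarith : ζ < f (k + 1))) (by
        have := EReal.add_lt_add_left_coe hfν ζ
        rw [← EReal.coe_add] at this
        simpa using this)
      obtain ⟨D, hD, hDn⟩ := hsd k
      have h3 : Metric.infEDist 0 (limSubdiff F (w (k + 1))) ≤ ENNReal.ofReal (C * a k) := by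
        refine (Metric.infEDist_le_edist_of_mem hD).trans ?_
        rw [edist_comm, edist_zero_right, ← ofReal_norm]
        exact ENNReal.ofReal_le_ofReal hDn
      have hd := hφ.deriv_pos _ hpos hfν
      have h4 := h2.trans (mul_le_mul_right h3 _)
      rw [← ENNReal.ofReal_mul hd.le, ENNReal.one_le_ofReal] at h4
      exact h4
  -- Budget of the radius: `δ/4` for the starting point, `δ/4` for the length already controlled by
  -- `χ k0`, and `δ/2` for one more step, whose KL estimate is available only once its endpoint is
  -- in the ball.
  have hfreq : ∃ k0, (∀ k, k0 ≤ k → R k - ζ < ν0 ∧ a k < δ / 2) ∧ ‖w k0 - wbar‖ < δ / 4 ∧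
      χ k0 < δ / 4 := by
    obtain ⟨N, hN⟩ := eventually_atTop.1 (hsmall.and (ha0.eventually_lt_const (half_pos hδ)))
    have e1 : ∀ᶠ j in atTop, ‖w (ks j) - wbar‖ < δ / 4 := by
      have := (tendsto_iff_norm_sub_tendsto_zero.1 hcl)
      exact this.eventually_lt_const (by linarith)
    have e2 : ∀ᶠ j in atTop, χ (ks j) < δ / 4 :=
      (hχ0.comp hks).eventually_lt_const (by linarith)
    obtain ⟨j, hj1, hj2, hj3⟩ := (e1.and (e2.and (hks.eventually_ge_atTop N))).exists
    exact ⟨ks j, fun k hk => hN k (hj3.trans hk), hj1, hj2⟩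
  obtain ⟨k0, hk0, hw0, hχk0⟩ := hfreq
  have hχnn : ∀ k, k0 ≤ k → 0 ≤ χ k := by
    intro k hk
    have h1 := hRζ k
    have h2 := (hk0 k hk).1
    have : 0 ≤ φ ((R k - ζ) / 2) := hφ.nonneg _ (by linarith)
      (lt_trans (by exact_mod_cast (by linarith)) hνν)
    positivity
  have htrap : ∀ j, ‖w (k0 + j) - w k0‖ ≤ ∑ i ∈ Finset.range j, a (k0 + i) ∧
      ∑ i ∈ Finset.range j, a (k0 + i) ≤ χ k0 - χ (k0 + j) := by
    intro j
    induction j with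
    | zero => simp
    | succ j ih =>
      have h1 : ‖w (k0 + (j + 1)) - w k0‖ ≤ ∑ i ∈ Finset.range (j + 1), a (k0 + i) := by
        rw [Finset.sum_range_succ]
        have : w (k0 + (j + 1)) - w k0 =
            (w (k0 + j) - w k0) + (w (k0 + j + 1) - w (k0 + j)) := by
          rw [← add_assoc]; abel
        rw [this]
        exact (norm_add_le _ _).trans (add_le_add ih.1 le_rfl)
      refine ⟨h1, ?_⟩
      have hmem : w (k0 + j + 1) ∈ Metric.ball wbar δ := by
        rw [Metric.mem_ball, dist_eq_norm]
        have : w (k0 + j + 1) - wbar = (w (k0 + j + 1) - w (k0 + j)) +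
            (w (k0 + j) - w k0) + (w k0 - wbar) := by abel
        rw [this]
        have h2 := (hk0 (k0 + j) (by omega)).2
        have h3 := hχnn (k0 + j) (by omega)
        refine lt_of_le_of_lt (norm_add₃_le) ?_
        simp only [ha] at h2
        linarith [ih.1, ih.2]
      have h2 := hstep (k0 + j) (hk0 _ (by omega)).1 hmem
      rw [Finset.sum_range_succ, ← add_assoc]
      linarith [ih.2]
  have hsum : Summable a := by
    rw [← summable_nat_add_iff k0]
    refine summable_of_sum_range_le (c := χ k0) (fun _ => norm_nonneg _) fun j => ?_
    have := (htrap j).2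
    have h3 := hχnn (k0 + j) (by omega)
    simp only [add_comm _ k0]
    linarith
  refine ⟨hsum, ?_⟩
  have hcau : CauchySeq w := cauchySeq_of_summable_dist (by
    simpa [ha, dist_eq_norm, norm_sub_rev] using hsum)
  exact tendsto_nhds_of_cauchySeq_of_subseq hcau hks hcl

end

/-! ### Relative error bound for one step. -/

theorem norm_pair_sq (U V : Mat n r) : ‖pair U V‖ ^ 2 = ‖U‖ ^ 2 + ‖V‖ ^ 2 :=
  WithLp.prod_norm_sq_eq_of_L2 _

theorem pair_sub (U V X Y : Mat n r) : pair U V - pair X Y = pair (U - X) (V - Y) := rfl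

theorem norm_le_norm_pair_left (U V : Mat n r) : ‖U‖ ≤ ‖pair U V‖ := by
  refine (sq_le_sq₀ (norm_nonneg _) (norm_nonneg _)).1 ?_
  rw [norm_pair_sq]; linarith [sq_nonneg ‖V‖]

theorem norm_le_norm_pair_right (U V : Mat n r) : ‖V‖ ≤ ‖pair U V‖ := by
  refine (sq_le_sq₀ (norm_nonneg _) (norm_nonneg _)).1 ?_
  rw [norm_pair_sq]; linarith [sq_nonneg ‖U‖]

theorem norm_pair_le (U V : Mat n r) : ‖pair U V‖ ≤ ‖U‖ + ‖V‖ := by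
  refine (sq_le_sq₀ (norm_nonneg _) (by positivity)).1 ?_
  rw [norm_pair_sq]
  nlinarith [mul_nonneg (norm_nonneg U) (norm_nonneg V)]

theorem IsProxSubgradient.pair {ψ φ : Mat n r → EReal} {K : ℝ} {U V D D' : Mat n r}
    (hU : IsProxSubgradient ψ K U D) (hV : IsProxSubgradient φ K V D') :
    IsProxSubgradient (fun w : MatPair n r => ψ w.fst + φ w.snd) K (pair U V)
      (ANAUM.pair D D') := by
  intro w
  have e : inner ℝ (ANAUM.pair D D') (w - ANAUM.pair U V) - K * ‖w - ANAUM.pair U V‖ ^ 2 =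
      (inner ℝ D (w.fst - U) - K * ‖w.fst - U‖ ^ 2) +
      (inner ℝ D' (w.snd - V) - K * ‖w.snd - V‖ ^ 2) := by
    rw [WithLp.prod_norm_sq_eq_of_L2, inner_pair]
    simp only [WithLp.sub_fst, WithLp.sub_snd, pair_fst, pair_snd]
    ring
  rw [e, EReal.coe_add, add_add_add_comm]
  exact add_le_add (hU w.fst) (hV w.snd)

theorem norm_adjoint_mulTL_le (U : Mat n r) (T : Mat n n) :
    ‖ContinuousLinearMap.adjoint (mulTL n r U) T‖ ≤ ‖mulTL n r‖ * ‖U‖ * ‖T‖ := by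
  rw [← adjoint_mulTRight_transp, ← norm_transp T]
  exact norm_adjoint_mulTRight_le U _

theorem residual_sub (P : GSMF n r q) (U V X Y : Mat n r) :
    P.residual U V - P.residual X Y =
      ContinuousLinearMap.adjoint P.A (P.A (mulT (U - X) V + mulT X (V - Y))) := by
  simp only [GSMF.residual, ← map_sub, mulT_sub_left, mulT_sub_right]
  congr 1
  simp only [map_add, map_sub]
  abel

theorem norm_residual_le (P : GSMF n r q) {M : ℝ} {X Y : Mat n r} (hX : ‖X‖ ≤ M)
    (hY : ‖Y‖ ≤ M) :
    ‖P.residual X Y‖ ≤ ‖P.A‖ * (‖P.A‖ * (‖mulTL n r‖ * M * M) + ‖P.b‖) := by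
  have hM : 0 ≤ M := (norm_nonneg X).trans hX
  refine (ContinuousLinearMap.le_opNorm _ _).trans ?_
  rw [LinearIsometryEquiv.norm_map]
  gcongr
  refine (norm_sub_le _ _).trans ?_
  gcongr
  refine (P.A.le_opNorm _).trans ?_
  gcongr
  refine (norm_mulT_le X Y).trans ?_
  gcongr

theorem norm_residual_sub_le (P : GSMF n r q) {M d : ℝ} {U V X Y : Mat n r} (hX : ‖X‖ ≤ M)
    (hV : ‖V‖ ≤ M) (h1 : ‖U - X‖ ≤ d) (h2 : ‖V - Y‖ ≤ d) :
    ‖P.residual U V - P.residual X Y‖ ≤ ‖P.A‖ * (‖P.A‖ * (2 * ‖mulTL n r‖ * M)) * d := by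
  have hM : 0 ≤ M := (norm_nonneg X).trans hX
  have hd : 0 ≤ d := (norm_nonneg _).trans h1
  rw [residual_sub, mul_assoc]
  refine (ContinuousLinearMap.le_opNorm _ _).trans ?_
  rw [LinearIsometryEquiv.norm_map]
  gcongr
  rw [mul_assoc]
  refine (P.A.le_opNorm _).trans ?_
  gcongr
  calc ‖mulT (U - X) V + mulT X (V - Y)‖ ≤ ‖mulT (U - X) V‖ + ‖mulT X (V - Y)‖ :=
        norm_add_le _ _
    _ ≤ ‖mulTL n r‖ * ‖U - X‖ * ‖V‖ + ‖mulTL n r‖ * ‖X‖ * ‖V - Y‖ :=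
        add_le_add (norm_mulT_le _ _) (norm_mulT_le _ _)
    _ ≤ ‖mulTL n r‖ * d * M + ‖mulTL n r‖ * M * d := by gcongr
    _ = _ := by ring

/-- Relative error bound for one accepted step with bounded data. -/
theorem exists_subgradient_bound {P : GSMF n r q} {S : Params} (hA : AssumptionA P S.α S.β)
    {M : ℝ} (hM : 0 ≤ M) :
    ∃ K C : ℝ, 0 ≤ C ∧ ∀ (X Y U V : Mat n r) (μ σ : ℝ), ‖X‖ ≤ M → ‖Y‖ ≤ M → ‖U‖ ≤ M → ‖V‖ ≤ M →
      |μ| ≤ M → |σ| ≤ M → P.UUpdate S.α X Y (P.zUpdate S X Y) μ U →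
      P.VUpdate S.α U Y (P.zUpdate S X Y) σ V → P.F (pair U V) < ⊤ →
      ∃ D D' : Mat n r, IsProxSubgradient P.Ψ K U D ∧ IsProxSubgradient P.Φ K V D' ∧
        ‖D‖ ≤ C ∧ ‖D'‖ ≤ C ∧ ∃ G ∈ frechetSubdiff P.F (pair U V),
          ‖G‖ ≤ C * ‖pair U V - pair X Y‖ := by
  set b := ‖mulTL n r‖ with hb
  have hb0 : 0 ≤ b := norm_nonneg (mulTL n r)
  set T₀ := ‖P.A‖ * (‖P.A‖ * (b * M * M) + ‖P.b‖) with hT₀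
  set T₁ := ‖P.A‖ * (‖P.A‖ * (2 * b * M)) with hT₁
  have hT₀' : 0 ≤ T₀ := by positivity
  have hT₁' : 0 ≤ T₁ := by positivity
  set k := (r + 1) * (|S.α| * (b * M) ^ 2 + M) with hk
  have hk0 : 0 ≤ k := by positivity
  -- `C₁`, `C₂` bound the subgradients of `Ψ`, `Φ` themselves; `C₃`, `C₄` bound the two blocks of
  -- the subgradient of `F` relative to the step.
  set C₁ := k * (2 * M) + b * M * T₀ + |P.lam| * (2 * M) with hC₁
  set C₂ := k * (2 * M) + b * M * (T₀ + |S.α| * (b * (2 * M) * M)) + |P.lam| * (2 * M) with hC₂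
  set C₃ := k + b * T₀ + b * M * T₁ + |P.lam| with hC₃
  set C₄ := k + b * M * (T₁ + |S.α| * (b * M)) with hC₄
  have h1 : 0 ≤ C₁ := by positivity
  have h2 : 0 ≤ C₂ := by positivity
  have h3 : 0 ≤ C₃ := by positivity
  have h4 : 0 ≤ C₄ := by positivity
  have hRes0 : ∀ {X Y : Mat n r}, ‖X‖ ≤ M → ‖Y‖ ≤ M → ‖P.residual X Y‖ ≤ T₀ :=
    fun hX hY => norm_residual_le P hX hY
  have hRes1 : ∀ {U V X Y : Mat n r} {d : ℝ}, ‖X‖ ≤ M → ‖V‖ ≤ M → ‖U - X‖ ≤ d → ‖V - Y‖ ≤ d →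
      ‖P.residual U V - P.residual X Y‖ ≤ T₁ * d :=
    fun hX hV h1 h2 => norm_residual_sub_le P hX hV h1 h2
  have hAdj : ∀ {Y : Mat n r} {T : Mat n n} {s t : ℝ}, ‖Y‖ ≤ s → ‖T‖ ≤ t →
      ‖ContinuousLinearMap.adjoint (mulTRight Y) T‖ ≤ b * s * t := fun {Y T s t} hs ht =>
    (norm_adjoint_mulTRight_le Y T).trans
      (mul_le_mul (mul_le_mul_of_nonneg_left hs hb0) ht (norm_nonneg _)
        (mul_nonneg hb0 ((norm_nonneg _).trans hs)))
  have hAdj' : ∀ {Y : Mat n r} {T : Mat n n} {s t : ℝ}, ‖Y‖ ≤ s → ‖T‖ ≤ t →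
      ‖ContinuousLinearMap.adjoint (mulTL n r Y) T‖ ≤ b * s * t := fun {Y T s t} hs ht =>
    (norm_adjoint_mulTL_le Y T).trans
      (mul_le_mul (mul_le_mul_of_nonneg_left hs hb0) ht (norm_nonneg _)
        (mul_nonneg hb0 ((norm_nonneg _).trans hs)))
  have hMul : ∀ {X Y : Mat n r} {s t : ℝ}, ‖X‖ ≤ s → ‖Y‖ ≤ t → ‖mulT X Y‖ ≤ b * s * t :=
    fun {X Y s t} hs ht => (norm_mulT_le X Y).trans
      (mul_le_mul (mul_le_mul_of_nonneg_left hs hb0) ht (norm_nonneg _)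
        (mul_nonneg hb0 ((norm_nonneg _).trans hs)))
  have hlam : ∀ {W : Mat n r} {s : ℝ}, ‖W‖ ≤ s → ‖P.lam • W‖ ≤ |P.lam| * s :=
    fun {W s} hs => by
      rw [norm_smul, Real.norm_eq_abs]
      exact mul_le_mul_of_nonneg_left hs (abs_nonneg _)
  clear_value T₀ T₁ C₁ C₂ C₃ C₄
  refine ⟨|S.α| / 2 * (b * M) ^ 2 + |P.lam| / 2 + M / 2, C₁ + C₂ + C₃ + C₄, by positivity, ?_⟩
  intro X Y U V μ σ hX hY hU hV hμ hσ hUU hVV hfin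
  set Z := P.zUpdate S X Y with hZ
  have hT : S.α • (mulT X Y - Z) = P.residual X Y := hA.smul_mulT_sub_zUpdate X Y
  clear_value Z
  obtain ⟨D, hD, hDn⟩ := hUU.exists_isProxSubgradient
  obtain ⟨D', hD', hDn'⟩ :=
    ((GSMF.vUpdate_iff_uUpdate_transp P _ _ _ _ _ _).1 hVV).exists_isProxSubgradient
  simp only [← hb] at hD hDn hD' hDn'
  clear_value b
  have hUX : ‖U - X‖ ≤ 2 * M := (norm_sub_le _ _).trans (by linarith)
  have hUY : ‖U - Y‖ ≤ 2 * M := (norm_sub_le _ _).trans (by linarith)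
  have hVY : ‖V - Y‖ ≤ 2 * M := (norm_sub_le _ _).trans (by linarith)
  have hVU : ‖V - U‖ ≤ 2 * M := (norm_sub_le _ _).trans (by linarith)
  -- `Z` is not refreshed between the blocks, so the second one sees an additional term, of the
  -- order of the step.
  have hres : S.α • (mulT U Y - Z) = P.residual X Y + S.α • mulT (U - X) Y := by
    rw [← hT, mulT_sub_left]; module
  have hgV : S.α • ContinuousLinearMap.adjoint (mulTRight U) (mulT Y U - transp Z) =
      ContinuousLinearMap.adjoint (mulTL n r U) (P.residual X Y + S.α • mulT (U - X) Y) := by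
    rw [← transp_mulT U Y, ← transp_sub, adjoint_mulTRight_transp, ← hres, map_smul]
  rw [hgV] at hDn'
  rw [← map_smul, hT] at hDn
  have hDn1 : ‖D + (ContinuousLinearMap.adjoint (mulTRight Y) (P.residual X Y) +
      P.lam • (U - Y))‖ ≤ k * ‖U - X‖ := by
    refine hDn.trans ?_
    rw [hk, mul_assoc]
    gcongr
  have hDn2 : ‖D' + (ContinuousLinearMap.adjoint (mulTL n r U)
      (P.residual X Y + S.α • mulT (U - X) Y) + P.lam • (V - U))‖ ≤ k * ‖V - Y‖ := by
    refine hDn'.trans ?_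
    rw [hk, mul_assoc]
    gcongr
  have hK1 : IsProxSubgradient P.Ψ (|S.α| / 2 * (b * M) ^ 2 + |P.lam| / 2 + M / 2) U D :=
    hD.mono (by gcongr)
  have hK2 : IsProxSubgradient P.Φ (|S.α| / 2 * (b * M) ^ 2 + |P.lam| / 2 + M / 2) V D' :=
    hD'.mono (by gcongr)
  have hm : ∀ d, ‖U - X‖ ≤ d → ‖S.α • mulT (U - X) Y‖ ≤ |S.α| * (b * d * M) := by
    intro d hd
    have hd0 := (norm_nonneg _).trans hd
    rw [norm_smul, Real.norm_eq_abs]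
    exact mul_le_mul_of_nonneg_left (hMul hd hY) (abs_nonneg _)
  clear_value k
  refine ⟨D, D', hK1, hK2, ?_, ?_, pair D D' + P.smoothGrad U V,
    (hK1.pair hK2).add_mem_frechetSubdiff hfin (hasFDerivAt_smooth P U V), ?_⟩
  · refine le_trans ?_ (by linarith : C₁ ≤ _)
    have e : D = (D + (ContinuousLinearMap.adjoint (mulTRight Y) (P.residual X Y) +
      P.lam • (U - Y))) - ContinuousLinearMap.adjoint (mulTRight Y) (P.residual X Y) -
      P.lam • (U - Y) := by abel
    rw [e, hC₁]
    refine (norm_sub_le _ _).trans (add_le_add ((norm_sub_le _ _).trans (add_le_add ?_ ?_)) ?_)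
    · exact hDn1.trans (mul_le_mul_of_nonneg_left hUX hk0)
    · exact hAdj hY (hRes0 hX hY)
    · exact hlam hUY
  · refine le_trans ?_ (by linarith : C₂ ≤ _)
    have e : D' = (D' + (ContinuousLinearMap.adjoint (mulTL n r U)
      (P.residual X Y + S.α • mulT (U - X) Y) + P.lam • (V - U))) -
      ContinuousLinearMap.adjoint (mulTL n r U) (P.residual X Y + S.α • mulT (U - X) Y) -
      P.lam • (V - U) := by abel
    rw [e, hC₂]
    refine (norm_sub_le _ _).trans (add_le_add ((norm_sub_le _ _).trans (add_le_add ?_ ?_)) ?_)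
    · exact hDn2.trans (mul_le_mul_of_nonneg_left hVY hk0)
    · exact hAdj' hU ((norm_add_le _ _).trans (add_le_add (hRes0 hX hY) (hm _ hUX)))
    · exact hlam hVU
  · set d := ‖pair U V - pair X Y‖ with hd
    have hd1 : ‖U - X‖ ≤ d := norm_le_norm_pair_left (U - X) (V - Y)
    have hd2 : ‖V - Y‖ ≤ d := norm_le_norm_pair_right (U - X) (V - Y)
    have hd0 : 0 ≤ d := norm_nonneg _
    have hR1 := hRes1 hX hV hd1 hd2
    refine le_trans ?_ (mul_le_mul_of_nonneg_right (by linarith : C₃ + C₄ ≤ _) hd0)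
    -- Each block is its near-cancelling sum from `hDn1` or `hDn2` plus terms containing a
    -- difference of old and new data.
    have e : pair D D' + P.smoothGrad U V = pair
      ((D + (ContinuousLinearMap.adjoint (mulTRight Y) (P.residual X Y) + P.lam • (U - Y))) +
        ContinuousLinearMap.adjoint (mulTRight (V - Y)) (P.residual U V) +
        ContinuousLinearMap.adjoint (mulTRight Y) (P.residual U V - P.residual X Y) -
        P.lam • (V - Y))
      ((D' + (ContinuousLinearMap.adjoint (mulTL n r U)
        (P.residual X Y + S.α • mulT (U - X) Y) + P.lam • (V - U))) +
        ContinuousLinearMap.adjoint (mulTL n r U)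
          ((P.residual U V - P.residual X Y) - S.α • mulT (U - X) Y)) := by
      have e1 : pair D D' + P.smoothGrad U V = pair
        (D + (ContinuousLinearMap.adjoint (mulTRight V) (P.residual U V) + P.lam • (U - V)))
        (D' + (ContinuousLinearMap.adjoint (mulTL n r U) (P.residual U V) + P.lam • (V - U))) :=
        rfl
      rw [e1]
      congr 1
      · rw [mulTRight_sub]
        simp only [map_sub, sub_apply]
        module
      · simp only [map_sub, map_add]
        abel
    rw [e, add_mul]
    refine (norm_pair_le _ _).trans (add_le_add ?_ ?_)
    · rw [hC₃, add_mul, add_mul, add_mul]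
      refine (norm_sub_le _ _).trans (add_le_add ((norm_add_le _ _).trans (add_le_add
        ((norm_add_le _ _).trans (add_le_add ?_ ?_)) ?_)) ?_)
      · exact hDn1.trans (mul_le_mul_of_nonneg_left hd1 hk0)
      · rw [mul_right_comm b T₀ d]
        exact hAdj hd2 (hRes0 hU hV)
      · rw [mul_assoc (b * M)]
        exact hAdj hY hR1
      · exact hlam hd2
    · rw [hC₄, add_mul, mul_assoc (b * M), add_mul]
      refine (norm_add_le _ _).trans (add_le_add ?_ ?_)
      · exact hDn2.trans (mul_le_mul_of_nonneg_left hd2 hk0)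
      · refine hAdj' hU ((norm_sub_le _ _).trans (add_le_add hR1 ((hm d hd1).trans_eq ?_)))
        ring

/-! ### Boundedness of sublevel sets and finiteness of the objective -/

theorem GSMF.F_eq (P : GSMF n r q) (w : MatPair n r) :
    P.F w = P.Ψ w.fst + P.Φ w.snd + (P.smooth w : EReal) := rfl

theorem GSMF.smooth_nonneg {P : GSMF n r q} (hlam : 0 ≤ P.lam) (w : MatPair n r) :
    0 ≤ P.smooth w := by
  unfold GSMF.smooth; positivity

theorem GSMF.continuous_smooth (P : GSMF n r q) : Continuous P.smooth := by
  have h1 : Continuous fun w : MatPair n r => w.fst :=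
    (WithLp.fstL 2 ℝ (Mat n r) (Mat n r)).continuous
  have h2 : Continuous fun w : MatPair n r => w.snd :=
    (WithLp.sndL 2 ℝ (Mat n r) (Mat n r)).continuous
  have h3 : Continuous fun w : MatPair n r => mulT w.fst w.snd :=
    ((mulTL n r).continuous.comp h1).clm_apply h2
  unfold GSMF.smooth
  exact (((P.A.continuous.comp h3).sub continuous_const).norm.pow 2 |>.const_mul _).add
    (((h1.sub h2).norm.pow 2).const_mul _)

theorem AssumptionA.exists_coe {P : GSMF n r q} {α β : ℝ} (hA : AssumptionA P α β) :
    ∃ m m' : ℝ, (∀ x, (m : EReal) ≤ P.Ψ x) ∧ (∀ x, (m' : EReal) ≤ P.Φ x) ∧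
      ∀ w, P.F w < ⊤ → ∃ x y : ℝ, m ≤ x ∧ m' ≤ y ∧ P.Ψ w.fst = x ∧ P.Φ w.snd = y ∧
        P.F w = ((x + y + P.smooth w : ℝ) : EReal) := by
  obtain ⟨m, hm⟩ := hA.psi.bddBelow
  obtain ⟨m', hm'⟩ := hA.phi.bddBelow
  refine ⟨m, m', hm, hm', fun w hw => ?_⟩
  rw [GSMF.F_eq] at hw
  have hb1 : P.Ψ w.fst ≠ ⊥ := ne_bot_of_le_ne_bot (EReal.coe_ne_bot m) (hm _)
  have hb2 : P.Φ w.snd ≠ ⊥ := ne_bot_of_le_ne_bot (EReal.coe_ne_bot m') (hm' _)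
  have ht1 : P.Ψ w.fst ≠ ⊤ := fun h => by
    rw [h, EReal.top_add_of_ne_bot hb2, EReal.top_add_coe] at hw
    exact lt_irrefl _ hw
  have ht2 : P.Φ w.snd ≠ ⊤ := fun h => by
    rw [h, EReal.add_top_of_ne_bot hb1, EReal.top_add_coe] at hw
    exact lt_irrefl _ hw
  have e1 := EReal.coe_toReal ht1 hb1
  have e2 := EReal.coe_toReal ht2 hb2
  refine ⟨(P.Ψ w.fst).toReal, (P.Φ w.snd).toReal, ?_, ?_, e1.symm, e2.symm, ?_⟩
  · have := hm w.fst
    rw [← e1] at this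
    exact_mod_cast this
  · have := hm' w.snd
    rw [← e2] at this
    exact_mod_cast this
  · rw [GSMF.F_eq, EReal.coe_add, EReal.coe_add, e1, e2]

/-- `‖A(XXᵀ)‖` is homogeneous of degree two and positive on the compact unit sphere; `δ` is its
minimum there. -/
theorem exists_pos_mul_sq_le {P : GSMF n r q}
    (h : ∀ X : Mat n r, P.A (mulT X X) = 0 → X = 0) :
    ∃ δ : ℝ, 0 < δ ∧ ∀ X : Mat n r, δ * ‖X‖ ^ 2 ≤ ‖P.A (mulT X X)‖ := by
  rcases subsingleton_or_nontrivial (Mat n r) with hs | hs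
  · refine ⟨1, one_pos, fun X => ?_⟩
    rw [Subsingleton.elim X 0]; simp
  have hcont : Continuous fun X : Mat n r => ‖P.A (mulT X X)‖ := by
    have : (fun X : Mat n r => ‖P.A (mulT X X)‖) = fun X => ‖P.A (mulTL n r X X)‖ := rfl
    rw [this]; fun_prop
  obtain ⟨X₀, hX₀, hmin⟩ := (isCompact_sphere (0 : Mat n r) 1).exists_isMinOn
    (NormedSpace.sphere_nonempty.2 zero_le_one) hcont.continuousOn
  have hX₀' : ‖X₀‖ = 1 := by simpa using hX₀
  refine ⟨‖P.A (mulT X₀ X₀)‖, norm_pos_iff.2 fun h0 => ?_, fun X => ?_⟩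
  · rw [h X₀ h0, norm_zero] at hX₀'
    exact zero_ne_one hX₀'
  · rcases eq_or_ne X 0 with rfl | hX
    · simp
    have hXp : 0 < ‖X‖ := norm_pos_iff.2 hX
    have h1 : ‖X‖⁻¹ • X ∈ Metric.sphere (0 : Mat n r) 1 := by
      simp [norm_smul, hXp.ne']
    have h2 : ‖P.A (mulT X₀ X₀)‖ ≤ ‖P.A (mulTL n r (‖X‖⁻¹ • X) (‖X‖⁻¹ • X))‖ := hmin h1
    simp only [map_smul, smul_apply, norm_smul, norm_inv, norm_norm,
      mulTL_apply] at h2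
    calc _ ≤ ‖X‖⁻¹ * (‖X‖⁻¹ * ‖P.A (mulT X X)‖) * ‖X‖ ^ 2 := by gcongr
      _ = _ := by field_simp

/-- In the case not assumed, the `lam` term bounds `U - V` on a sublevel set and the data term
bounds `A(UVᵀ)`. Hence `A(UUᵀ)` grows at most linearly in `‖U‖`, against the quadratic lower bound
`δ ‖U‖²`. -/
theorem AssumptionA.levelBounded_F {P : GSMF n r q} {α β : ℝ} (hA : AssumptionA P α β) :
    LevelBounded P.F := by
  by_cases hcase : P.lam = 0 ∨ ∃ X : Mat n r, X ≠ 0 ∧ P.A (mulT X X) = 0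
  · exact hA.levelBounded hcase
  push Not at hcase
  obtain ⟨hlam, hinj⟩ := hcase
  have hlam0 : 0 < P.lam := lt_of_le_of_ne hA.lam_nonneg (Ne.symm hlam)
  obtain ⟨δ, hδ, hX⟩ := exists_pos_mul_sq_le (P := P) fun X h => by
    by_contra hne; exact hinj X hne h
  obtain ⟨m, m', -, -, hF⟩ := hA.exists_coe
  intro t
  -- Bound for the smooth part on the sublevel set; `e` and `d` then bound the data residual and `U
  -- - V`.
  set s := t - m - m' with hs
  set e := √(2 * s)
  set d := √(2 * s / P.lam)
  set p := e + ‖P.b‖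
  set k := ‖P.A‖ * (‖mulTL n r‖ * d)
  have hp : 0 ≤ p := by positivity
  have hk : 0 ≤ k := by positivity
  rw [isBounded_iff_forall_norm_le]
  refine ⟨2 * (1 + (p + k) / δ) + d, fun w hw => ?_⟩
  have hwt : P.F w ≤ (t : EReal) := hw
  obtain ⟨x, y, hx, hy, -, -, hFw⟩ := hF w (hwt.trans_lt (EReal.coe_lt_top t))
  rw [hFw, EReal.coe_le_coe_iff] at hwt
  have hsm : P.smooth w ≤ s := by linarith
  unfold GSMF.smooth at hsm
  set U := w.fst
  set V := w.snd
  have h1 : ‖P.A (mulT U V) - P.b‖ ≤ e := by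
    apply Real.le_sqrt_of_sq_le
    have : 0 ≤ P.lam / 2 * ‖U - V‖ ^ 2 := by positivity
    linarith
  have h2 : ‖U - V‖ ≤ d := by
    apply Real.le_sqrt_of_sq_le
    rw [le_div_iff₀ hlam0]
    have : 0 ≤ 1 / 2 * ‖P.A (mulT U V) - P.b‖ ^ 2 := by positivity
    linarith
  have h3 : ‖P.A (mulT U U)‖ ≤ p + k * ‖U‖ := by
    have e1 : P.A (mulT U U) = (P.A (mulT U V) - P.b) + P.b + P.A (mulT U (U - V)) := by
      rw [mulT_sub_right, map_sub]; abel
    rw [e1]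
    refine (norm_add_le _ _).trans (add_le_add ((norm_add_le _ _).trans (add_le_add h1 le_rfl)) ?_)
    calc ‖P.A (mulT U (U - V))‖ ≤ ‖P.A‖ * (‖mulTL n r‖ * ‖U‖ * ‖U - V‖) :=
          (P.A.le_opNorm _).trans (by gcongr; exact norm_mulT_le _ _)
      _ ≤ ‖P.A‖ * (‖mulTL n r‖ * ‖U‖ * d) := by gcongr
      _ = k * ‖U‖ := by ring
  have h4 : ‖U‖ ≤ 1 + (p + k) / δ := by
    rcases le_or_gt ‖U‖ 1 with hU | hU
    · have : 0 ≤ (p + k) / δ := by positivity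
      linarith
    · have h5 : ‖U‖ ≤ (p + k) / δ := by
        rw [le_div_iff₀ hδ]
        have h6 : (‖U‖ * δ) * ‖U‖ ≤ (p + k) * ‖U‖ := by
          have := (hX U).trans h3
          nlinarith
        exact le_of_mul_le_mul_right h6 (by linarith)
      linarith
  have h5 : ‖V‖ ≤ ‖U‖ + ‖U - V‖ := by
    have : V = U - (U - V) := by abel
    calc ‖V‖ = ‖U - (U - V)‖ := by rw [← this]
      _ ≤ _ := norm_sub_le _ _
  have h6 : ‖w‖ ≤ ‖U‖ + ‖V‖ := norm_pair_le U V
  linarith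

theorem tendsto_fst {u : ℕ → MatPair n r} {a : MatPair n r} (h : Tendsto u atTop (𝓝 a)) :
    Tendsto (fun k => (u k).fst) atTop (𝓝 a.fst) :=
  ((WithLp.fstL 2 ℝ (Mat n r) (Mat n r)).continuous.tendsto a).comp h

theorem tendsto_snd {u : ℕ → MatPair n r} {a : MatPair n r} (h : Tendsto u atTop (𝓝 a)) :
    Tendsto (fun k => (u k).snd) atTop (𝓝 a.snd) :=
  ((WithLp.sndL 2 ℝ (Mat n r) (Mat n r)).continuous.tendsto a).comp h

/-! ### Consequences of the acceptance criterion -/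

variable {P : GSMF n r q} {S : Params} {X Y : ℕ → Mat n r} {R p : ℕ → ℝ}

theorem GSMF.Accepts.lt_top {X Y U V : Mat n r} {R : ℝ} (h : P.Accepts S X Y R U V) :
    P.F (pair U V) < ⊤ := by
  rw [lt_top_iff_ne_top]
  intro ht
  unfold GSMF.Accepts at h
  rw [ht, EReal.top_sub_coe, top_le_iff] at h
  exact EReal.coe_ne_top _ h

theorem IsRun.lt_top (h : IsRun P S X Y R p) (k : ℕ) : P.F (pair (X k) (Y k)) < ⊤ := by
  cases k with
  | zero => exact h.start_mem_dom
  | succ k =>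
    obtain ⟨_, _, _, _, _, _, _, _, hacc⟩ := h.step k
    exact hacc.lt_top

theorem IsRun.coe_toReal (hA : AssumptionA P S.α S.β) (h : IsRun P S X Y R p) (k : ℕ) :
    ((P.F (pair (X k) (Y k))).toReal : EReal) = P.F (pair (X k) (Y k)) := by
  obtain ⟨m, m', -, -, hF⟩ := hA.exists_coe
  obtain ⟨x, y, -, -, -, -, e⟩ := hF _ (h.lt_top k)
  rw [e, EReal.toReal_coe]

theorem IsRun.descent (hA : AssumptionA P S.α S.β) (h : IsRun P S X Y R p) (k : ℕ) :
    (P.F (pair (X (k + 1)) (Y (k + 1)))).toReal ≤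
      R k - S.c / 2 * ‖pair (X (k + 1)) (Y (k + 1)) - pair (X k) (Y k)‖ ^ 2 := by
  obtain ⟨_, _, _, _, _, _, _, _, hacc⟩ := h.step k
  unfold GSMF.Accepts at hacc
  rw [← h.coe_toReal hA, ← EReal.coe_sub, EReal.coe_le_coe_iff] at hacc
  rw [pair_sub, norm_pair_sq]
  linarith

/-- The new reference is a convex combination of the old one and the new value, which lies below it.
-/
theorem IsRun.toReal_le_ref (hA : AssumptionA P S.α S.β) (hS : S.Admissible P)
    (h : IsRun P S X Y R p) (k : ℕ) : (P.F (pair (X k) (Y k))).toReal ≤ R k := by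
  cases k with
  | zero => exact h.ref_zero.ge
  | succ k =>
    rw [h.ref_succ k]
    have h1 := h.descent hA k
    have h2 : 0 ≤ S.c / 2 * ‖pair (X (k + 1)) (Y (k + 1)) - pair (X k) (Y k)‖ ^ 2 := by
      have := hS.c_pos
      positivity
    nlinarith [h.weight k]

/-- The proximal parameters of the accepted candidates stay bounded along bounded iterates. -/
theorem IsRun.exists_updates (hA : AssumptionA P S.α S.β) (hS : S.Admissible P)
    (h : IsRun P S X Y R p) {M : ℝ} (hX : ∀ k, ‖X k‖ ≤ M) (hY : ∀ k, ‖Y k‖ ≤ M) :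
    ∃ B : ℝ, ∀ k, ∃ μ σ : ℝ, |μ| ≤ B ∧ |σ| ≤ B ∧
      P.UUpdate S.α (X k) (Y k) (P.zUpdate S (X k) (Y k)) μ (X (k + 1)) ∧
      P.VUpdate S.α (X (k + 1)) (Y k) (P.zUpdate S (X k) (Y k)) σ (Y (k + 1)) := by
  set cb := |S.α + 2 * S.γ * P.rho S| * (‖toOperator n r‖ * M) ^ 2 + S.c with hcb
  have hm : 0 < min S.μmin S.c := lt_min hS.mu_min_pos hS.c_pos
  have hσm : 0 < S.σmax := hS.sigma_min_pos.trans hS.sigma_min_lt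
  have hτ : 0 < S.τ := zero_lt_one.trans hS.one_lt_tau
  have hcb0 : 0 ≤ cb := by have := hS.c_pos; positivity
  have hB0 : 0 ≤ S.τ * (S.σmax / min S.μmin S.c * cb) := by positivity
  refine ⟨cb + S.τ * (S.σmax / min S.μmin S.c * cb), fun k => ?_⟩
  obtain ⟨μ₀, σ₀, μ, σ, hμ₀, hσ₀, hσ₀', htrial, -⟩ := h.step k
  obtain ⟨hU, hV⟩ := htrial.updates
  obtain ⟨b1, b2, b3, -, b5⟩ := htrial.bounds hS (c_le_cap hA hS) hμ₀ hσ₀ hσ₀'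
  have hc1 : P.cap S (Y k) ≤ cb := cap_le (hY k)
  have hc2 : P.cap S (X (k + 1)) ≤ cb := cap_le (hX (k + 1))
  refine ⟨μ, σ, ?_, ?_, hU, hV⟩
  · rw [abs_of_nonneg (hm.le.trans b1)]; linarith
  · rw [abs_of_nonneg b3]
    rcases b5 with b5 | b5
    · have : S.τ * (S.σmax / min S.μmin S.c * P.cap S (Y k)) ≤
          S.τ * (S.σmax / min S.μmin S.c * cb) := by gcongr
      linarith
    · linarith

end ANAUM

end

/-! ### Convergence of the algorithm. -/

theorem theorem5p2 {n r q : ℕ} (P : ANAUM.GSMF n r q) (S : ANAUM.Params)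
    (hA : ANAUM.AssumptionA P S.α S.β) (hS : S.Admissible P)
    (hKL : ANAUM.IsKLFunction P.F)
    (X Y : ℕ → ANAUM.Mat n r) (R p : ℕ → ℝ) (hrun : ANAUM.IsRun P S X Y R p) :
    (∃ Xlim Ylim : ANAUM.Mat n r,
      Tendsto X atTop (𝓝 Xlim) ∧ Tendsto Y atTop (𝓝 Ylim) ∧
      ANAUM.IsStationary P.F (ANAUM.pair Xlim Ylim)) ∧
    Summable (fun k => ‖X (k + 1) - X k‖ + ‖Y (k + 1) - Y k‖) := by
  open ANAUM in
  set w : ℕ → MatPair n r := fun k => pair (X k) (Y k) with hw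
  set f : ℕ → ℝ := fun k => (P.F (w k)).toReal with hf
  have hFf : ∀ k, P.F (w k) = (f k : EReal) := fun k => (hrun.coe_toReal hA k).symm
  have hdesc : ∀ k, f (k + 1) ≤ R k - S.c / 2 * ‖w (k + 1) - w k‖ ^ 2 := hrun.descent hA
  have hfR : ∀ k, f k ≤ R k := hrun.toReal_le_ref hA hS
  have hdec := sq_le_sub_of_averaged_descent hS.c_pos hdesc hS.pmin_pos
    (fun k => (hrun.weight k).1) hrun.ref_succ
  have hκ : 0 < S.pmin * S.c / 2 := by
    have := hS.c_pos; have := hS.pmin_pos; positivity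
  have hanti : Antitone R := antitone_nat_of_succ_le fun k => by
    have := hdec k
    have h2 : 0 ≤ S.pmin * S.c / 2 * ‖w (k + 1) - w k‖ ^ 2 := by positivity
    linarith
  obtain ⟨m, m', hm, hm', hF⟩ := hA.exists_coe
  have hfm : ∀ k, ∃ x y : ℝ, m ≤ x ∧ m' ≤ y ∧ P.Ψ (X k) = x ∧ P.Φ (Y k) = y ∧
      f k = x + y + P.smooth (w k) := fun k => by
    obtain ⟨x, y, hx, hy, e1, e2, e3⟩ := hF (w k) (hrun.lt_top k)
    refine ⟨x, y, hx, hy, e1, e2, ?_⟩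
    rw [hFf] at e3
    exact_mod_cast e3
  have hsm : ∀ k, 0 ≤ P.smooth (w k) := fun k => GSMF.smooth_nonneg hA.lam_nonneg _
  obtain ⟨ζ, hRlim⟩ : ∃ ζ, Tendsto R atTop (𝓝 ζ) := by
    refine ⟨_, tendsto_atTop_ciInf hanti ⟨m + m', ?_⟩⟩
    rintro _ ⟨k, rfl⟩
    obtain ⟨x, y, hx, hy, -, -, e⟩ := hfm k
    have := hfR k
    have := hsm k
    linarith
  have ha0 := tendsto_zero_of_sq_le_sub hκ (fun k => norm_nonneg _) hdec hRlim
  -- The values need not be monotone, but `R k - R (k + 1) = p (k + 1) (R k - f (k + 1))` with `p ≥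
  -- pmin` forces their gap to `R` to vanish.
  have hflim : Tendsto (fun k => f (k + 1)) atTop (𝓝 ζ) := by
    have h1 : Tendsto (fun k => R k - (R k - R (k + 1)) / S.pmin) atTop (𝓝 ζ) := by
      have := hRlim.sub ((hRlim.sub (hRlim.comp (tendsto_add_atTop_nat 1))).div_const S.pmin)
      simpa using this
    refine tendsto_of_tendsto_of_tendsto_of_le_of_le h1 hRlim (fun k => ?_) (fun k => ?_)
    · have h2 : R k - R (k + 1) = p (k + 1) * (R k - f (k + 1)) := by
        rw [hrun.ref_succ k]; ring
      have h3 : f (k + 1) ≤ R k := (hfR (k + 1)).trans (hanti (Nat.le_succ k))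
      have h4 : R k - f (k + 1) ≤ (R k - R (k + 1)) / S.pmin := by
        rw [le_div_iff₀ hS.pmin_pos, h2, mul_comm]
        exact mul_le_mul_of_nonneg_right (hrun.weight k).1 (by linarith)
      simp only
      linarith
    · exact (hfR (k + 1)).trans (hanti (Nat.le_succ k))
  have hbdd := hA.levelBounded_F (R 0)
  have hmem : ∀ k, w k ∈ {x | P.F x ≤ (R 0 : EReal)} := fun k => by
    rw [Set.mem_ofPred_eq, hFf, EReal.coe_le_coe_iff]
    exact (hfR k).trans (hanti (Nat.zero_le k))
  obtain ⟨M₀, hM₀⟩ := isBounded_iff_forall_norm_le.1 hbdd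
  have hX : ∀ k, ‖X k‖ ≤ M₀ := fun k => (norm_le_norm_pair_left _ _).trans (hM₀ _ (hmem k))
  have hY : ∀ k, ‖Y k‖ ≤ M₀ := fun k => (norm_le_norm_pair_right _ _).trans (hM₀ _ (hmem k))
  obtain ⟨B, hB⟩ := hrun.exists_updates hA hS hX hY
  have hM0 : 0 ≤ max M₀ B := le_max_of_le_left ((norm_nonneg _).trans (hX 0))
  obtain ⟨K, C, hC, hsub⟩ := exists_subgradient_bound hA hM0
  have hex : ∀ k, ∃ D D' : Mat n r, IsProxSubgradient P.Ψ K (X (k + 1)) D ∧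
      IsProxSubgradient P.Φ K (Y (k + 1)) D' ∧ ‖D‖ ≤ C ∧ ‖D'‖ ≤ C ∧
      ∃ G ∈ frechetSubdiff P.F (w (k + 1)), ‖G‖ ≤ C * ‖w (k + 1) - w k‖ := fun k => by
    obtain ⟨μ, σ, hμ, hσ, hU, hV⟩ := hB k
    exact hsub (X k) (Y k) (X (k + 1)) (Y (k + 1)) μ σ (le_max_of_le_left (hX _))
      (le_max_of_le_left (hY _)) (le_max_of_le_left (hX _)) (le_max_of_le_left (hY _))
      (le_max_of_le_right hμ) (le_max_of_le_right hσ) hU hV (hrun.lt_top _)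
  choose D D' hD hD' hDC hDC' G hG hGC using hex
  -- The shift by one discards the starting point, for which no subgradient is known.
  obtain ⟨wbar, -, ks, hks, hcl⟩ := tendsto_subseq_of_bounded hbdd (x := fun k => w (k + 1))
    fun k => hmem (k + 1)
  have hcl' : Tendsto (fun j => w (ks j + 1)) atTop (𝓝 wbar) := hcl
  have hclX : Tendsto (fun j => X (ks j + 1)) atTop (𝓝 wbar.fst) := tendsto_fst hcl'
  have hclY : Tendsto (fun j => Y (ks j + 1)) atTop (𝓝 wbar.snd) := tendsto_snd hcl'
  have hfR0 : ∀ k, f k ≤ R 0 := fun k => (hfR k).trans (hanti (Nat.zero_le k))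
  -- The bound `R 0 - m'` comes from `f ≤ R 0`, `Φ ≥ m'` and nonnegativity of the smooth part.
  obtain ⟨hΨ, hΨlim⟩ := tendsto_of_isProxSubgradient hA.psi.lsc (C := R 0 - m') hm hclX
    (fun j => by
      obtain ⟨x, y, hx, hy, e1, -, e⟩ := hfm (ks j + 1)
      rw [e1, EReal.coe_le_coe_iff]
      linarith [hfR0 (ks j + 1), hsm (ks j + 1)])
    (fun j => hD (ks j)) (fun j => hDC (ks j))
  obtain ⟨hΦ, hΦlim⟩ := tendsto_of_isProxSubgradient hA.phi.lsc (C := R 0 - m) hm' hclY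
    (fun j => by
      obtain ⟨x, y, hx, hy, -, e2, e⟩ := hfm (ks j + 1)
      rw [e2, EReal.coe_le_coe_iff]
      linarith [hfR0 (ks j + 1), hsm (ks j + 1)])
    (fun j => hD' (ks j)) (fun j => hDC' (ks j))
  have hsmlim : Tendsto (fun j => P.smooth (w (ks j + 1))) atTop (𝓝 (P.smooth wbar)) :=
    (P.continuous_smooth.tendsto wbar).comp hcl'
  have hbarfin : P.F wbar < ⊤ := by
    rw [GSMF.F_eq]
    exact EReal.add_lt_top (EReal.add_lt_top (hΨ.trans_lt (EReal.coe_lt_top _)).ne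
      (hΦ.trans_lt (EReal.coe_lt_top _)).ne).ne (EReal.coe_ne_top _)
  -- KL at `wbar` measures values against `F wbar`, so it must equal the limit of the references.
  have hζ : P.F wbar = (ζ : EReal) := by
    obtain ⟨x, y, -, -, e1, e2, e3⟩ := hF wbar hbarfin
    rw [e3, EReal.coe_eq_coe_iff]
    rw [e1, EReal.toReal_coe] at hΨlim
    rw [e2, EReal.toReal_coe] at hΦlim
    refine tendsto_nhds_unique ((hΨlim.add hΦlim).add hsmlim) ?_
    refine (hflim.comp hks.tendsto_atTop).congr fun j => ?_
    obtain ⟨x', y', -, -, e1', e2', e⟩ := hfm (ks j + 1)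
    simp only [Function.comp_apply]
    rw [e, e1', e2', EReal.toReal_coe, EReal.toReal_coe]
  have hstat : IsStationary P.F wbar := by
    refine ⟨hbarfin, fun j => w (ks j + 1), fun j => G (ks j), hcl', ?_, ?_, fun j => hG (ks j)⟩
    · rw [hζ]
      simp only [hFf]
      exact (continuous_coe_real_ereal.tendsto ζ).comp (hflim.comp hks.tendsto_atTop)
    · have hG0 : Tendsto G atTop (𝓝 0) :=
        squeeze_zero_norm hGC (by simpa using ha0.const_mul C)
      exact hG0.comp hks.tendsto_atTop
  -- Constant sequences exhibit a regular subgradient as a limiting one.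
  have hlim : ∀ k, G k ∈ limSubdiff P.F (w (k + 1)) := fun k =>
    ⟨(hG k).1, fun _ => w (k + 1), fun _ => G k, tendsto_const_nhds, tendsto_const_nhds,
      tendsto_const_nhds, fun _ => hG k⟩
  obtain ⟨hsum, htend⟩ := summable_and_tendsto_of_hasKLAt hS.pmin_pos hS.c_pos hC
    (fun k => hFf (k + 1)) hζ (hKL wbar ⟨0, hstat⟩) (fun k => ⟨G k, hlim k, hGC k⟩) hdesc
    hrun.weight hrun.ref_succ hRlim
    (ks := fun j => ks j + 1) ((tendsto_add_atTop_nat 1).comp hks.tendsto_atTop) hcl'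
  refine ⟨⟨wbar.fst, wbar.snd, tendsto_fst htend, tendsto_snd htend, hstat⟩, ?_⟩
  refine (hsum.mul_left 2).of_nonneg_of_le (fun k => by positivity) fun k => ?_
  have h1 : ‖X (k + 1) - X k‖ ≤ ‖w (k + 1) - w k‖ := norm_le_norm_pair_left _ (Y (k + 1) - Y k)
  have h2 : ‖Y (k + 1) - Y k‖ ≤ ‖w (k + 1) - w k‖ := norm_le_norm_pair_right (X (k + 1) - X k) _
  linarith
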